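/- Let $F_2=\langle x,y\rangle$ be the free group of rank two, and let $X$ be the Brady complex, that is, the following 2-complex, on which $\mathrm{Aut}(F_2)$ acts. Its vertices are the free bases $\{a,b\}$ of $F_2$, up to permuting and inverting the basis elements; its edges join $\{a,b\}$ to $\{ab,b\}$; its faces are the equilateral triangles with side $1$ and vertices $\{a,b\},\{b,ab\},\{ab,a\}$, and the lozenges with side $1$ and successive vertices $\{a,b\},\{ab,b\},\{bab,b\},\{ba,b\}$ whose large angles, equal to $2\pi/3$, are at $\{a,b\}$ and $\{bab,b\}$ (in all cases $(a,b)$ runs over the free bases of $F_2$). A \emph{Hamiltonian surface} in $X$ is a subcomplex which is a connected surface without boundary (every vertex link is a circle) and which contains every vertex and every edge of $X$; it is endowed with its length metric. Then $X$ has precisely two Hamiltonian surfaces. If they are denoted $\Sigma_1$ and $\Sigma_2$, there exist finite index subgroups $G_1$ and $G_2$ of $\mathrm{Aut}(F_2)$ stabilizing $\Sigma_1$ and $\Sigma_2$ respectively, a group isomorphism $\varphi\colon G_1\to G_2$, and a bijective isometry $\psi\colon \Sigma_1\to\Sigma_2$, which is also an isomorphism of cell complexes (it takes vertices, edges, triangles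 and lozenges of $\Sigma_1$ onto vertices, edges, triangles and lozenges of $\Sigma_2$), such that $\psi(g_1x_1)=\varphi(g_1)\psi(x_1)$ for every $x_1\in\Sigma_1$ and every $g_1\in G_1$. -/

import Mathlib

open scoped ENNReal

namespace Brady

/-! ### The Brady complex

The Brady complex `X` is described through the free bases of the free group `F₂ = ⟨x, y⟩`.
Its vertices are the bases `{a, b}` up to permuting and inverting the two basis elements; the group
`Aut(F₂)` permutes them transitively, and the stabilizer of a vertex is dihedral of order 8.
Two vertices `{a, b}` and `{a b, b}` are joined by an edge.  The faces are

* triangles, with vertices `{a, b}`, `{b, a b}`, `{a b, a}`;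
* lozenges, with vertices `{a, b}`, `{a b, b}`, `{b a b, b}`, `{b a, b}` in cyclic order, the two
  large angles (of size `2π/3`) being at `{a, b}` and `{b a b, b}`.

Every edge is incident to exactly three faces (one triangle and two lozenges), and the link of each
vertex is a Moebius ladder with four rungs.  When lozenges are cut along their short diagonals, this
is the complex of cosets of `⟨σ₃σ₂σ₁⟩` in the four string braid group, where `B₄` acts through
`B₄ / Z(B₄) ≃ Aut⁺(F₂)`. -/

/-- The free group on two generators. -/
abbrev F2 : Type := FreeGroup (Fin 2)

/-- The automorphism group of the free group on two generators. -/
abbrev AutF2 : Type := MulAut F2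

/-- `(a, b)` is a free basis of `F₂`. -/
def IsBasis (a b : F2) : Prop :=
  ∃ f : AutF2, f (FreeGroup.of 0) = a ∧ f (FreeGroup.of 1) = b

/-- The pair `(a, b)` up to permuting and inverting its entries. -/
def frame (a b : F2) : Set F2 := {a, a⁻¹, b, b⁻¹}

/-- Vertices of `X`: free bases up to permuting and inverting the basis elements. -/
def IsVertex (v : Set F2) : Prop :=
  ∃ a b, IsBasis a b ∧ v = frame a b

/-- Edges of `X`, given by their sets of end points. -/
def IsEdge (e : Set (Set F2)) : Prop :=
  ∃ a b, IsBasis a b ∧ e = {frame a b, frame (a * b) b}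

/-- Triangles of `X`, given by their vertex sets. -/
def IsTriangle (t : Set (Set F2)) : Prop :=
  ∃ a b, IsBasis a b ∧ t = {frame a b, frame b (a * b), frame (a * b) a}

/-- The vertex set of the lozenge of `X` associated with a basis `(a, b)`. -/
def lozenge (a b : F2) : Set (Set F2) :=
  {frame a b, frame (a * b) b, frame (b * a * b) b, frame (b * a) b}

/-- Lozenges of `X`, given by their vertex sets. -/
def IsLozenge (l : Set (Set F2)) : Prop :=
  ∃ a b, IsBasis a b ∧ l = lozenge a b

/-- The (2-dimensional) faces of `X`. -/
def IsFace (f : Set (Set F2)) : Prop := IsTriangle f ∨ IsLozenge f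

/-- Subcomplexes of `X`.  The boundary edges of a face are precisely the edges of `X` whose end
points are vertices of the face (no diagonal of a lozenge is an edge). -/
@[ext]
structure Subcomplex where
  verts : Set (Set F2)
  edges : Set (Set (Set F2))
  faces : Set (Set (Set F2))
  isVertex_of_mem : ∀ v ∈ verts, IsVertex v
  isEdge_of_mem : ∀ e ∈ edges, IsEdge e
  isFace_of_mem : ∀ f ∈ faces, IsFace f
  endpoint_mem : ∀ e ∈ edges, ∀ v ∈ e, v ∈ verts
  boundary_mem : ∀ f ∈ faces, ∀ e, IsEdge e → e ⊆ f → e ∈ edges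

namespace Subcomplex

/-! ### Hamiltonian surfaces -/

/-- The 1-skeleton of a subcomplex. -/
def skeleton (S : Subcomplex) : SimpleGraph S.verts where
  Adj v w := v ≠ w ∧ ({v.1, w.1} : Set (Set F2)) ∈ S.edges
  symm := ⟨fun _ _ h => ⟨h.1.symm, by rw [Set.pair_comm]; exact h.2⟩⟩
  loopless := ⟨fun _ h => h.1 rfl⟩

/-- The link of a vertex `v` in a subcomplex: its vertices are the edges of the subcomplex which
are incident to `v`, and two of them are joined whenever they are the two sides at `v` of a face of
the subcomplex. -/
def link (S : Subcomplex) (v : Set F2) : SimpleGraph {e : Set (Set F2) // e ∈ S.edges ∧ v ∈ e} where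
  Adj e e' := e ≠ e' ∧ ∃ f ∈ S.faces, e.1 ⊆ f ∧ e'.1 ⊆ f
  symm := ⟨fun _ _ h => ⟨h.1.symm, h.2.imp fun _ hf => ⟨hf.1, hf.2.2, hf.2.1⟩⟩⟩
  loopless := ⟨fun _ h => h.1 rfl⟩

/-- A subcomplex is a connected surface without boundary if it is (nonempty and) connected and the
link of each of its vertices is a circle. -/
def IsSurface (S : Subcomplex) : Prop :=
  S.skeleton.Connected ∧
    ∀ v ∈ S.verts, ∃ n, 3 ≤ n ∧ Nonempty (S.link v ≃g SimpleGraph.cycleGraph n)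

/-- A Hamiltonian surface of `X`: an embedded connected surface without boundary which visits every
vertex and every edge of `X` (precisely once, since it is embedded). -/
def IsHamiltonianSurface (S : Subcomplex) : Prop :=
  S.IsSurface ∧ (∀ v, IsVertex v → v ∈ S.verts) ∧ (∀ e, IsEdge e → e ∈ S.edges)

end Subcomplex

/-! ### Geometric realization

A point of (the realization of) `X` is given by its barycentric coordinates, where every lozenge is
cut along its short diagonal into two equilateral triangles. -/

/-- Systems of barycentric coordinates. -/
abbrev Coord : Type := Set F2 →₀ ℝ

/-- The points with barycentric coordinates supported in a given set of vertices. -/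
def closedSimplex (s : Set (Set F2)) : Set Coord :=
  {p | (∀ v, 0 ≤ p v) ∧ (p.sum fun _ r => r) = 1 ∧ (p.support : Set (Set F2)) ⊆ s}

/-- The equilateral triangles which make up a face: a triangle is left as it is, and a lozenge is
cut along its short diagonal, which joins its two large angles. -/
def pieces (f : Set (Set F2)) : Set (Set (Set F2)) :=
  {s | (IsTriangle f ∧ s = f) ∨
    ∃ a b, IsBasis a b ∧ f = lozenge a b ∧
      (s = {frame a b, frame (a * b) b, frame (b * a * b) b} ∨
        s = {frame a b, frame (b * a) b, frame (b * a * b) b})}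

/-- The closed face of the realization of `X` with given vertex set. -/
def closedFace (f : Set (Set F2)) : Set Coord := ⋃ s ∈ pieces f, closedSimplex s

/-- The Euclidean distance between two points of an equilateral triangle of side 1, in terms of
barycentric coordinates. -/
noncomputable def simplexDist (p q : Coord) : ℝ :=
  Real.sqrt (((p - q).sum fun _ r => r ^ 2) / 2)

/-- The action of `Aut(F₂)` on `X`: an automorphism permutes the vertices by taking a basis to its
image, and it is affine on each simplex. -/
noncomputable def act (g : AutF2) (p : Coord) : Coord :=
  p.mapDomain fun v => g '' v

namespace Subcomplex

/-- The simplices of a subcomplex, after cutting the lozenges. -/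
def simplices (S : Subcomplex) : Set (Set (Set F2)) :=
  {s | (∃ v ∈ S.verts, s = {v}) ∨ s ∈ S.edges ∨ ∃ f ∈ S.faces, s ∈ pieces f}

/-- The geometric realization of a subcomplex. -/
def realization (S : Subcomplex) : Set Coord := ⋃ s ∈ S.simplices, closedSimplex s

/-- `x 0, …, x n` is a string of points of the subcomplex: any two consecutive points lie in a
common closed simplex. -/
def IsString (S : Subcomplex) (n : ℕ) (x : ℕ → Coord) : Prop :=
  ∀ i < n, ∃ s ∈ S.simplices, x i ∈ closedSimplex s ∧ x (i + 1) ∈ closedSimplex s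

/-- The length metric of a subcomplex in which every triangle is a Euclidean equilateral triangle
of side 1, and every lozenge is a Euclidean lozenge with sides of length 1: the infimum of the
lengths of the strings joining two points. -/
noncomputable def pathDist (S : Subcomplex) (p q : S.realization) : ℝ≥0∞ :=
  ⨅ (n : ℕ) (x : ℕ → Coord) (_ : S.IsString n x) (_ : x 0 = p) (_ : x n = q),
    ENNReal.ofReal (∑ i ∈ Finset.range n, simplexDist (x i) (x (i + 1)))

/-- `G` stabilizes the subcomplex `S`. -/
def Stabilizes (G : Subgroup AutF2) (S : Subcomplex) : Prop :=
  ∀ g ∈ G, act g '' S.realization = S.realization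

theorem Stabilizes.act_mem {G : Subgroup AutF2} {S : Subcomplex} (h : Stabilizes G S) (g : G)
    (p : S.realization) : act (g : AutF2) p ∈ S.realization :=
  (h g g.2).subset (Set.mem_image_of_mem _ p.2)

/-- The closed cells of each kind in a subcomplex. -/
def vertexCells (S : Subcomplex) : Set (Set Coord) := {K | ∃ v ∈ S.verts, K = closedSimplex {v}}

def edgeCells (S : Subcomplex) : Set (Set Coord) := closedSimplex '' S.edges

def triangleCells (S : Subcomplex) : Set (Set Coord) :=
  closedFace '' {f | f ∈ S.faces ∧ IsTriangle f}

def lozengeCells (S : Subcomplex) : Set (Set Coord) :=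
  closedFace '' {f | f ∈ S.faces ∧ IsLozenge f}

/-- A bijection `ψ` between realizations takes the family `A` of subsets of the source to the
family `B` of subsets of the target. -/
def CarriesCells {S T : Subcomplex} (ψ : S.realization ≃ T.realization)
    (A B : Set (Set Coord)) : Prop :=
  (fun K : Set Coord => (fun p : S.realization => (ψ p : Coord)) '' {p | (p : Coord) ∈ K}) '' A = B

/-- Isometric isomorphisms: bijections which preserve the length metrics, and take vertices to
vertices, edges to edges, triangles to triangles and lozenges to lozenges. -/
structure IsIsometricIso {S T : Subcomplex} (ψ : S.realization ≃ T.realization) : Prop where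
  isometry : ∀ p q, T.pathDist (ψ p) (ψ q) = S.pathDist p q
  vertices : CarriesCells ψ S.vertexCells T.vertexCells
  edges : CarriesCells ψ S.edgeCells T.edgeCells
  triangles : CarriesCells ψ S.triangleCells T.triangleCells
  lozenges : CarriesCells ψ S.lozengeCells T.lozengeCells

end Subcomplex

end Brady

/-! The proof describes Hamiltonian surfaces locally, at the vertex of a basis `(a, b)`, and
globally by means of Nielsen's theorem.

*Local description.* A vertex has eight neighbors and twelve faces, and its link is a Moebius
ladder with four rungs, the large corners of lozenges; along its rim, triangles alternate with
small corners of lozenges (`nbr_mem_face`, `exists_face_of_isFace`). The lozenges of the bases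
`(bⁱ a bʲ, b)` tile a plane, so that the lozenges at a vertex belong to two planes. In a
Hamiltonian surface the link of a vertex is an 8-cycle in the Moebius ladder, hence it omits one
of the three edges at each vertex of the ladder. Following the omitted faces along a triangle
shows that the lozenges of `(a, b)` and of `(b, a)` are never both omitted
(`Subcomplex.IsHamiltonianSurface.lozenge_mem_or`). What is left at each vertex are two
possibilities: all triangles belong to the surface, and in one of the two planes exactly the small
corners are omitted, in the other plane exactly the large ones. In other words, the property
`ε a b` that the lozenge of `(a, b)` belongs to the surface is invariant under inverting `a` or `b`,
and it is reversed by exchanging `a` and `b`, and by replacing `a` with `a * b` (`IsAlternating`).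

*Global description.* By Nielsen's theorem (`IsBasis.isNielsenBasis`), all bases are obtained from
the standard one by these moves, so that there are at most two alternating `ε`. Conversely, the
sign of the permutation of the three nonzero vectors of `(ℤ/2)²` induced by a basis is
alternating, and alternating functions define Hamiltonian surfaces, which are connected by
Nielsen's theorem again (`isHamiltonianSurface_surface`). Hence there are precisely two
Hamiltonian surfaces. Both are stabilized by the automorphisms of sign 1, a subgroup of index 2,
and they are exchanged by the automorphism which exchanges the generators. The latter provides the
isometry, and the group isomorphism is conjugation by it.

*Nielsen's theorem.* Let `com g h` be the length of the common prefix of the reduced words of `g`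
and `h`. It satisfies the ultrametric inequality `min_com_le`, and
`|g⁻¹ h| = |g| + |h| - 2 com g h`. If in each product of three elements of a basis and its inverses, without trivial partial
product, the middle element does not cancel completely, then a reduced product of `n` such
elements has length at least `n`, so that the basis consists of letters. Otherwise, an elementary
Nielsen move, possibly followed by a conjugation, makes the basis shorter. -/

namespace Brady

/-! ### Common prefixes in the free group -/

/-- Every two lists split off a common prefix after which their heads, if any, differ. -/
theorem exists_maximal_common_prefix {α : Type*} (l₁ l₂ : List α) :
    ∃ p u v, l₁ = p ++ u ∧ l₂ = p ++ v ∧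
      ∀ a b, a ∈ u.head? → b ∈ v.head? → a ≠ b := by
  classical
  induction l₁ generalizing l₂ with
  | nil => exact ⟨[], [], l₂, rfl, rfl, by simp⟩
  | cons a l₁ ih =>
    cases l₂ with
    | nil => exact ⟨[], a :: l₁, [], rfl, rfl, by simp⟩
    | cons b l₂ =>
      by_cases hab : a = b
      · obtain ⟨p, u, v, h₁, h₂, h⟩ := ih l₂
        exact ⟨a :: p, u, v, by simp [h₁], by simp [h₂, hab], h⟩
      · refine ⟨[], a :: l₁, b :: l₂, rfl, rfl, ?_⟩
        simpa using hab

/-- The length of the common prefix of the reduced words of `g` and `h`, written as a Gromov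
product of word lengths. -/
def com (g h : F2) : ℕ := (g.norm + h.norm - (g⁻¹ * h).norm) / 2

/-- The words of `g` and `h` cancel in `g⁻¹ * h` exactly along their maximal common prefix. -/
theorem exists_prefix (g h : F2) :
    ∃ p u v, g.toWord = p ++ u ∧ h.toWord = p ++ v ∧
      (g⁻¹ * h).norm = u.length + v.length ∧ com g h = p.length ∧
      ∀ a b, a ∈ u.head? → b ∈ v.head? → a ≠ b := by
  obtain ⟨p, u, v, hg, hh, hd⟩ := exists_maximal_common_prefix g.toWord h.toWord
  have hgr : FreeGroup.IsReduced (p ++ u) := hg ▸ FreeGroup.isReduced_toWord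
  have hhr : FreeGroup.IsReduced (p ++ v) := hh ▸ FreeGroup.isReduced_toWord
  have hu : FreeGroup.IsReduced u := hgr.infix (List.suffix_append p u).isInfix
  have hv : FreeGroup.IsReduced v := hhr.infix (List.suffix_append p v).isInfix
  have hu' : FreeGroup.IsReduced (FreeGroup.invRev u) := by
    rw [FreeGroup.isReduced_iff_reduce_eq, FreeGroup.reduce_invRev, hu.reduce_eq]
  have hred : FreeGroup.IsReduced (FreeGroup.invRev u ++ v) := by
    refine List.isChain_append.2 ⟨hu', hv, ?_⟩
    intro a ha b hb h1
    by_contra h2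
    refine hd (a.1, !a.2) b ?_ hb ?_
    · cases u with
      | nil => simp [FreeGroup.invRev] at ha
      | cons c u =>
        simp [FreeGroup.invRev] at ha
        simp [← ha]
    · refine Prod.ext h1 ?_
      · cases h : a.2 <;> cases h' : b.2 <;> simp_all
  have hn : (g⁻¹ * h).norm = u.length + v.length := by
    have : g⁻¹ * h = FreeGroup.mk (FreeGroup.invRev u ++ v) := by
      rw [← FreeGroup.mk_toWord (x := g), ← FreeGroup.mk_toWord (x := h), hg, hh,
        ← FreeGroup.mul_mk, ← FreeGroup.mul_mk, ← FreeGroup.mul_mk, ← FreeGroup.inv_mk]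
      group
    rw [this, FreeGroup.norm, FreeGroup.toWord_mk, hred.reduce_eq]
    simp
  have hg' : g.norm = p.length + u.length := by rw [FreeGroup.norm, hg]; simp
  have hh' : h.norm = p.length + v.length := by rw [FreeGroup.norm, hh]; simp
  refine ⟨p, u, v, hg, hh, hn, ?_, hd⟩
  rw [com]
  omega

theorem norm_inv_mul (g h : F2) : (g⁻¹ * h).norm + 2 * com g h = g.norm + h.norm := by
  obtain ⟨p, u, v, hg, hh, hn, hc, -⟩ := exists_prefix g h
  have hg' : g.norm = p.length + u.length := by rw [FreeGroup.norm, hg]; simp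
  have hh' : h.norm = p.length + v.length := by rw [FreeGroup.norm, hh]; simp
  omega

theorem norm_mul (g h : F2) : (g * h).norm + 2 * com g⁻¹ h = g.norm + h.norm := by
  simpa using norm_inv_mul g⁻¹ h

theorem le_com_iff {g h : F2} {k : ℕ} :
    k ≤ com g h ↔ k ≤ g.norm ∧ k ≤ h.norm ∧ g.toWord.take k = h.toWord.take k := by
  obtain ⟨p, u, v, hg, hh, hn, hc, hd⟩ := exists_prefix g h
  have hg' : g.norm = p.length + u.length := by rw [FreeGroup.norm, hg]; simp
  have hh' : h.norm = p.length + v.length := by rw [FreeGroup.norm, hh]; simp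
  constructor
  · intro hk
    rw [hc] at hk
    refine ⟨by omega, by omega, ?_⟩
    rw [hg, hh, List.take_append_of_le_length hk, List.take_append_of_le_length hk]
  · rintro ⟨h1, h2, h3⟩
    rw [hc]
    by_contra hk
    push Not at hk
    have hu : u ≠ [] := by rintro rfl; simp at hg'; omega
    have hv : v ≠ [] := by rintro rfl; simp at hh'; omega
    have h4 := congrArg (fun l => l[p.length]?) h3
    simp only [List.getElem?_take, hk, if_true, hg, hh] at h4
    rw [List.getElem?_append_right le_rfl, List.getElem?_append_right le_rfl] at h4
    simp only [Nat.sub_self] at h4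
    obtain ⟨a, u, rfl⟩ := List.exists_cons_of_ne_nil hu
    obtain ⟨b, v, rfl⟩ := List.exists_cons_of_ne_nil hv
    simp at h4
    exact hd a b (by simp) (by simp) h4

theorem com_comm (g h : F2) : com g h = com h g := by
  refine le_antisymm ?_ ?_ <;> rw [le_com_iff] <;>
    exact ⟨(le_com_iff.1 le_rfl).2.1, (le_com_iff.1 le_rfl).1, (le_com_iff.1 le_rfl).2.2.symm⟩

theorem min_com_le (g h k : F2) : min (com g h) (com h k) ≤ com g k := by
  obtain ⟨a1, a2, a3⟩ := le_com_iff.1 (min_le_left (com g h) (com h k))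
  obtain ⟨b1, b2, b3⟩ := le_com_iff.1 (min_le_right (com g h) (com h k))
  exact le_com_iff.2 ⟨a1, b2, a3.trans b3⟩

theorem com_eq_of_lt {g h k : F2} (hlt : com g h < com h k) : com g k = com g h := by
  have h1 := min_com_le g h k
  have h2 := min_com_le g k h
  rw [com_comm k h] at h2
  omega

/-- A free group has no element `g ≠ 1` such that half of `g` cancels in `g * g`. -/
theorem two_mul_com_inv_lt {g : F2} (hg : g ≠ 1) : 2 * com g⁻¹ g < g.norm := by
  by_contra hlt
  push Not at hlt
  obtain ⟨h1, h2, h3⟩ := le_com_iff.1 (le_refl (com g⁻¹ g))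
  have hred : FreeGroup.IsReduced g.toWord := FreeGroup.isReduced_toWord
  have hpos : g.norm ≠ 0 := by simpa using hg
  have hinv : ∀ i (hi : i < com g⁻¹ g) (h : i < g.toWord.length)
      (h' : g.toWord.length - 1 - i < g.toWord.length),
      g.toWord[i] = ((g.toWord[g.toWord.length - 1 - i]).1,
        !(g.toWord[g.toWord.length - 1 - i]).2) := by
    intro i hi h h'
    have h4 := congrArg (fun l => l[i]?) h3
    simp only [List.getElem?_take, hi, if_true, FreeGroup.toWord_inv, FreeGroup.invRev] at h4
    rw [List.getElem?_reverse (by simpa using h)] at h4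
    simp [h, h'] at h4
    rw [← h4]
  have hlen : g.toWord.length = g.norm := rfl
  rcases Nat.even_or_odd' g.norm with ⟨m, hm | hm⟩
  · have hm0 : m - 1 + 1 < g.toWord.length := by omega
    have h5 := hinv (m - 1) (by omega) (by omega) (by omega)
    have h6 := List.isChain_iff_getElem.1 hred (m - 1) hm0
    have h7 : g.toWord.length - 1 - (m - 1) = m - 1 + 1 := by omega
    simp only [h7] at h5
    rw [h5] at h6
    simp at h6
  · have h5 := hinv m (by omega) (by omega) (by omega)
    have h7 : g.toWord.length - 1 - m = m := by omega
    simp only [h7] at h5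
    have := congrArg Prod.snd h5
    simp at this

/-! ### Nielsen's theorem for the free group of rank two -/

theorem aut_ext {f g : AutF2} (h0 : f (.of 0) = g (.of 0)) (h1 : f (.of 1) = g (.of 1)) :
    f = g := by
  have : f.toMonoidHom = g.toMonoidHom := by
    ext i
    fin_cases i
    · exact h0
    · exact h1
  ext w
  exact DFunLike.congr_fun this w

/-- The automorphism exchanging the two generators. -/
def swapAut : AutF2 :=
  MonoidHom.toMulEquiv (FreeGroup.lift ![.of 1, .of 0]) (FreeGroup.lift ![.of 1, .of 0])
    (by ext i; fin_cases i <;> simp) (by ext i; fin_cases i <;> simp)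

/-- The automorphism inverting the first generator. -/
def invAut : AutF2 :=
  MonoidHom.toMulEquiv (FreeGroup.lift ![(.of 0)⁻¹, .of 1]) (FreeGroup.lift ![(.of 0)⁻¹, .of 1])
    (by ext i; fin_cases i <;> simp) (by ext i; fin_cases i <;> simp)

/-- The transvection multiplying the first generator by the second one on the right. -/
def mulAut : AutF2 :=
  MonoidHom.toMulEquiv (FreeGroup.lift ![.of 0 * .of 1, .of 1])
    (FreeGroup.lift ![.of 0 * (.of 1)⁻¹, .of 1])
    (by ext i; fin_cases i <;> simp) (by ext i; fin_cases i <;> simp)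

@[simp] theorem swapAut_zero : swapAut (.of 0) = .of 1 := by simp [swapAut]
@[simp] theorem swapAut_one : swapAut (.of 1) = .of 0 := by simp [swapAut]
@[simp] theorem invAut_zero : invAut (.of 0) = (.of 0)⁻¹ := by simp [invAut]
@[simp] theorem invAut_one : invAut (.of 1) = .of 1 := by simp [invAut]
@[simp] theorem mulAut_zero : mulAut (.of 0) = .of 0 * .of 1 := by simp [mulAut]
@[simp] theorem mulAut_one : mulAut (.of 1) = .of 1 := by simp [mulAut]

/-- The subgroup of `Aut(F₂)` generated by the elementary Nielsen automorphisms. -/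
def nielsen : Subgroup AutF2 := Subgroup.closure {swapAut, invAut, mulAut}

theorem swapAut_mem : swapAut ∈ nielsen := Subgroup.subset_closure (by simp)
theorem invAut_mem : invAut ∈ nielsen := Subgroup.subset_closure (by simp)
theorem mulAut_mem : mulAut ∈ nielsen := Subgroup.subset_closure (by simp)

namespace IsBasis

variable {a b : F2}

theorem of_of : IsBasis (.of 0) (.of 1) := ⟨1, rfl, rfl⟩

theorem swap (h : IsBasis a b) : IsBasis b a := by
  obtain ⟨f, rfl, rfl⟩ := h
  exact ⟨f * swapAut, by simp, by simp⟩

theorem inv_left (h : IsBasis a b) : IsBasis a⁻¹ b := by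
  obtain ⟨f, rfl, rfl⟩ := h
  exact ⟨f * invAut, by simp, by simp⟩

theorem mul_right (h : IsBasis a b) : IsBasis (a * b) b := by
  obtain ⟨f, rfl, rfl⟩ := h
  exact ⟨f * mulAut, by simp, by simp⟩

theorem inv_right (h : IsBasis a b) : IsBasis a b⁻¹ := h.swap.inv_left.swap

theorem mul_inv_right (h : IsBasis a b) : IsBasis (a * b⁻¹) b := by
  simpa using h.inv_right.mul_right.inv_right

theorem mul_left (h : IsBasis a b) : IsBasis (b * a) b := by
  simpa using h.inv_left.mul_inv_right.inv_left

theorem inv_mul_left (h : IsBasis a b) : IsBasis (b⁻¹ * a) b := by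
  simpa using h.inv_right.mul_left.inv_right

theorem map (h : IsBasis a b) (g : AutF2) : IsBasis (g a) (g b) := by
  obtain ⟨f, rfl, rfl⟩ := h
  exact ⟨g * f, rfl, rfl⟩

end IsBasis

/-- `(a, b)` is obtained from the standard basis by elementary Nielsen moves. -/
def IsNielsenBasis (a b : F2) : Prop :=
  ∃ f ∈ nielsen, f (.of 0) = a ∧ f (.of 1) = b

namespace IsNielsenBasis

variable {a b : F2}

theorem swap (h : IsNielsenBasis a b) : IsNielsenBasis b a := by
  obtain ⟨f, hf, rfl, rfl⟩ := h
  exact ⟨f * swapAut, mul_mem hf swapAut_mem, by simp, by simp⟩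

theorem inv_left (h : IsNielsenBasis a b) : IsNielsenBasis a⁻¹ b := by
  obtain ⟨f, hf, rfl, rfl⟩ := h
  exact ⟨f * invAut, mul_mem hf invAut_mem, by simp, by simp⟩

theorem mul_right (h : IsNielsenBasis a b) : IsNielsenBasis (a * b) b := by
  obtain ⟨f, hf, rfl, rfl⟩ := h
  exact ⟨f * mulAut, mul_mem hf mulAut_mem, by simp, by simp⟩

theorem inv_right (h : IsNielsenBasis a b) : IsNielsenBasis a b⁻¹ := h.swap.inv_left.swap

theorem mul_inv_right (h : IsNielsenBasis a b) : IsNielsenBasis (a * b⁻¹) b := by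
  simpa using h.inv_right.mul_right.inv_right

theorem mul_left (h : IsNielsenBasis a b) : IsNielsenBasis (b * a) b := by
  simpa using h.inv_left.mul_inv_right.inv_left

theorem inv_mul_left (h : IsNielsenBasis a b) : IsNielsenBasis (b⁻¹ * a) b := by
  simpa using h.inv_right.mul_left.inv_right

end IsNielsenBasis

theorem conj_mem_nielsen (g : F2) : MulAut.conj g ∈ nielsen := by
  have key : (⊤ : Subgroup F2) ≤ nielsen.comap (MulAut.conj : F2 →* AutF2) := by
    rw [← FreeGroup.closure_range_of, Subgroup.closure_le]
    have h : IsNielsenBasis (.of 0) (.of 1) := ⟨1, one_mem _, rfl, rfl⟩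
    rintro _ ⟨i, rfl⟩
    have : IsNielsenBasis (MulAut.conj (.of i : F2) (.of 0))
        (MulAut.conj (.of i : F2) (.of 1)) := by
      fin_cases i
      · simpa using h.swap.mul_left.mul_inv_right.swap
      · simpa using h.mul_left.mul_inv_right
    obtain ⟨f, hf, h0, h1⟩ := this
    have : f = MulAut.conj (.of i) := aut_ext h0 h1
    simpa [← this] using hf
  exact key (Subgroup.mem_top g)

theorem IsNielsenBasis.of_conj {a b : F2} (g : F2)
    (h : IsNielsenBasis (g⁻¹ * a * g) (g⁻¹ * b * g)) : IsNielsenBasis a b := by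
  obtain ⟨f, hf, h0, h1⟩ := h
  exact ⟨MulAut.conj g * f, mul_mem (conj_mem_nielsen g) hf, by simp [h0, mul_assoc],
    by simp [h1, mul_assoc]⟩

/-- The basis `(a, b)` can be replaced with a shorter one, by elementary Nielsen moves and
conjugations. -/
def IsReducible (a b : F2) : Prop :=
  ∃ a' b', IsBasis a' b' ∧ (IsNielsenBasis a' b' → IsNielsenBasis a b) ∧
    a'.norm + b'.norm < a.norm + b.norm

namespace IsReducible

variable {a b : F2}

theorem swap (h : IsReducible a b) : IsReducible b a := by
  obtain ⟨a', b', h1, h2, h3⟩ := h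
  exact ⟨a', b', h1, fun h => (h2 h).swap, by omega⟩

theorem of_inv_left (h : IsReducible a⁻¹ b) : IsReducible a b := by
  obtain ⟨a', b', h1, h2, h3⟩ := h
  refine ⟨a', b', h1, fun h => by simpa using (h2 h).inv_left, ?_⟩
  simpa using h3

theorem of_inv_right (h : IsReducible a b⁻¹) : IsReducible a b :=
  h.swap.of_inv_left.swap

theorem of_norm_mul_lt (h : IsBasis a b) (hlt : (a * b).norm < a.norm) : IsReducible a b :=
  ⟨a * b, b, h.mul_right, fun h => by simpa using h.mul_inv_right, by omega⟩

theorem of_norm_mul_lt' (h : IsBasis a b) (hlt : (b * a).norm < a.norm) : IsReducible a b :=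
  ⟨b * a, b, h.mul_left, fun h => by simpa [mul_assoc] using h.inv_mul_left, by omega⟩

end IsReducible

/-- If `a = q m r` and `b = (q r)⁻¹` without cancellation, then `a * b` is conjugate to `m`. This is
the case in which no elementary Nielsen move makes `(a, b)` shorter, and a conjugation is needed. -/
theorem IsReducible.of_two_mul_com_eq {a b : F2} (h : IsBasis a b) (hb : b ≠ 1)
    (hab : b.norm ≤ a.norm) (h₁ : 2 * com a⁻¹ b = b.norm) (h₂ : 2 * com b⁻¹ a = b.norm) :
    IsReducible a b := by
  have hb0 : b.norm ≠ 0 := by simpa using hb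
  set k := com a⁻¹ b with hk
  have hk2 : com b⁻¹ a = k := by omega
  obtain ⟨-, -, e1⟩ := le_com_iff.1 hk.le
  obtain ⟨-, -, e2⟩ := le_com_iff.1 hk2.ge
  have hA : a.toWord.length = a.norm := rfl
  have hB : b.toWord.length = b.norm := rfl
  obtain ⟨Q, M, R, hQ, hM, hR, hQMR⟩ : ∃ Q M R : List (Fin 2 × Bool), Q.length = k ∧
      M.length = a.norm - 2 * k ∧ R.length = k ∧ a.toWord = Q ++ (M ++ R) := by
    refine ⟨a.toWord.take k, (a.toWord.drop k).take (a.norm - 2 * k),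
      (a.toWord.drop k).drop (a.norm - 2 * k), ?_, ?_, ?_, ?_⟩
    · rw [List.length_take]; omega
    · rw [List.length_take, List.length_drop]; omega
    · rw [List.length_drop, List.length_drop]; omega
    · rw [List.take_append_drop, List.take_append_drop]
  have hBword : b.toWord = FreeGroup.invRev R ++ FreeGroup.invRev Q := by
    have hd : (b.toWord.drop k).length = k := by rw [List.length_drop]; omega
    rw [FreeGroup.toWord_inv, hQMR, ← List.append_assoc, FreeGroup.invRev_append,
      List.take_left' (by simpa using hR)] at e1
    rw [FreeGroup.toWord_inv, hQMR, List.take_left' hQ, ← List.take_append_drop k b.toWord,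
      FreeGroup.invRev_append, List.take_left' (by simpa using hd)] at e2
    rw [e1, ← e2, FreeGroup.invRev_invRev, List.take_append_drop]
  have ha' : a = .mk Q * (.mk M * .mk R) := by
    rw [← FreeGroup.mk_toWord (x := a), hQMR]; simp
  have hb' : b = (.mk R)⁻¹ * (.mk Q)⁻¹ := by
    rw [← FreeGroup.mk_toWord (x := b), hBword]; simp
  refine ⟨(.mk Q)⁻¹ * (a * b) * .mk Q, (.mk Q)⁻¹ * b * .mk Q, ?_, ?_, ?_⟩
  · simpa using h.mul_right.map (MulAut.conj (.mk Q)⁻¹)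
  · intro h'
    simpa using (IsNielsenBasis.of_conj _ h').mul_inv_right
  · have e3 : (.mk Q)⁻¹ * (a * b) * .mk Q = (.mk M : F2) := by rw [ha', hb']; group
    have e4 : (.mk Q)⁻¹ * b * .mk Q = (.mk (FreeGroup.invRev Q ++ FreeGroup.invRev R) : F2) := by
      rw [hb', ← FreeGroup.mul_mk, ← FreeGroup.inv_mk, ← FreeGroup.inv_mk]; group
    have e5 := FreeGroup.norm_mk_le (L₁ := M)
    have e6 := FreeGroup.norm_mk_le (L₁ := FreeGroup.invRev Q ++ FreeGroup.invRev R)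
    rw [List.length_append, FreeGroup.invRev_length, FreeGroup.invRev_length] at e6
    rw [e3, e4]
    omega

/-- If in a product `u * b * w` of basis elements all of the letters of `b` cancel, then the basis
can be made shorter. -/
theorem IsReducible.of_norm_le_com {a b u w : F2} (h : IsBasis a b) (hb : b ≠ 1)
    (hu : u = a ∨ u = a⁻¹ ∨ u = b) (hw : w = a ∨ w = a⁻¹ ∨ w = b)
    (hle : b.norm ≤ com u⁻¹ b + com b⁻¹ w) : IsReducible a b := by
  have hbb := two_mul_com_inv_lt hb
  have n1 := norm_mul u b
  have n2 := norm_mul b w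
  by_cases h1 : b.norm < 2 * com u⁻¹ b
  · rcases hu with rfl | rfl | rfl
    · exact .of_norm_mul_lt h (by omega)
    · exact .of_inv_left (.of_norm_mul_lt h.inv_left (by omega))
    · omega
  by_cases h2 : b.norm < 2 * com b⁻¹ w
  · rcases hw with rfl | rfl | rfl
    · exact .of_norm_mul_lt' h (by omega)
    · exact .of_inv_left (.of_norm_mul_lt' h.inv_left (by omega))
    · omega
  have hub : u ≠ b := by rintro rfl; omega
  have hwb : w ≠ b := by rintro rfl; omega
  have huw : w ≠ u⁻¹ := by
    rintro rfl
    have := min_com_le b⁻¹ u⁻¹ b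
    omega
  have key : ∀ a, IsBasis a b → 2 * com a⁻¹ b = b.norm → 2 * com b⁻¹ a = b.norm →
      IsReducible a b := by
    intro a h h3 h4
    by_cases hab : b.norm ≤ a.norm
    · exact .of_two_mul_com_eq h hb hab h3 h4
    · have := norm_mul a b
      exact .swap (.of_norm_mul_lt' h.swap (by omega))
  rcases hu with rfl | rfl | rfl
  · rcases hw with rfl | rfl | rfl
    · exact key _ h (by omega) (by omega)
    · exact absurd rfl huw
    · exact absurd rfl hwb
  · rcases hw with rfl | rfl | rfl
    · simp at huw
    · exact .of_inv_left (key _ h.inv_left (by omega) (by omega))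
    · exact absurd rfl hwb
  · exact absurd rfl hub

/-- The image of a letter under an automorphism. -/
def letterImage (f : AutF2) (l : Fin 2 × Bool) : F2 := f (.mk [l])

/-- The images of the generators under `f` form a Nielsen reduced basis: in a product of three basis
elements, some letter of the middle one does not cancel. -/
def IsNielsenReduced (f : AutF2) : Prop :=
  ∀ m l r, FreeGroup.IsReduced [m, l] → FreeGroup.IsReduced [l, r] →
    com (letterImage f m)⁻¹ (letterImage f l) + com (letterImage f l)⁻¹ (letterImage f r) <
      (letterImage f l).norm

/-- In a product of elements of a Nielsen reduced basis, the cancellation at the first factor is the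
same as if there were only two factors, and every factor contributes to the length. -/
theorem IsNielsenReduced.length_add_com_le {f : AutF2} (hf : IsNielsenReduced f)
    (L : List (Fin 2 × Bool)) (m l : Fin 2 × Bool) (hL : FreeGroup.IsReduced (m :: l :: L)) :
    com (letterImage f m)⁻¹ (f (.mk (l :: L))) = com (letterImage f m)⁻¹ (letterImage f l) ∧
      (l :: L).length + com (letterImage f m)⁻¹ (letterImage f l) ≤
        (f (.mk (l :: L))).norm := by
  induction L generalizing m l with
  | nil =>
    refine ⟨rfl, ?_⟩
    have hll : FreeGroup.IsReduced [l, l] := by simp [FreeGroup.isReduced_cons_cons]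
    have := hf m l l hL hll
    change 0 + 1 + _ ≤ (letterImage f l).norm
    omega
  | cons l' L ih =>
    rw [FreeGroup.isReduced_cons_cons] at hL
    obtain ⟨i1, i2⟩ := ih l l' hL.2
    have hml : FreeGroup.IsReduced [m, l] := by simpa [FreeGroup.isReduced_cons_cons] using hL.1
    have hll' : FreeGroup.IsReduced [l, l'] := by
      simpa [FreeGroup.isReduced_cons_cons] using (FreeGroup.isReduced_cons_cons.1 hL.2).1
    have hr := hf m l l' hml hll'
    have hprod : f (.mk (l :: l' :: L)) = letterImage f l * f (.mk (l' :: L)) := by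
      rw [letterImage, ← map_mul, FreeGroup.mul_mk]; rfl
    have n1 := norm_mul (letterImage f l) (f (.mk (l' :: L)))
    have n2 := norm_inv_mul (letterImage f l) (f (.mk (l :: l' :: L)))
    rw [← hprod] at n1
    have e : (letterImage f l)⁻¹ * f (.mk (l :: l' :: L)) = f (.mk (l' :: L)) := by
      rw [hprod]; group
    rw [e] at n2
    refine ⟨com_eq_of_lt (by omega), ?_⟩
    simp only [List.length_cons] at i2 ⊢
    omega

theorem IsNielsenReduced.length_le {f : AutF2} (hf : IsNielsenReduced f) (w : F2) :
    w.norm ≤ (f w).norm := by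
  rw [FreeGroup.norm]
  nth_rw 2 [← FreeGroup.mk_toWord (x := w)]
  have hred : FreeGroup.IsReduced w.toWord := FreeGroup.isReduced_toWord
  cases hw : w.toWord with
  | nil => simp
  | cons l L =>
    rw [hw] at hred
    have := (hf.length_add_com_le L l l
      (FreeGroup.isReduced_cons_cons.2 ⟨fun _ => rfl, hred⟩)).2
    omega

theorem exists_eq_mk_of_norm_eq_one {w : F2} (hw : w.norm = 1) : ∃ l, w = .mk [l] := by
  obtain ⟨l, hl⟩ := List.length_eq_one_iff.1 hw
  exact ⟨l, by rw [← FreeGroup.mk_toWord (x := w), hl]⟩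

theorem mk_false (i : Fin 2) : (FreeGroup.mk [(i, false)] : F2) = (.of i)⁻¹ := rfl

theorem mk_true (i : Fin 2) : (FreeGroup.mk [(i, true)] : F2) = .of i := rfl

/-- Since `f` does not shorten any word, the preimages of the generators are letters. -/
theorem mem_nielsen_of_isNielsenReduced {f : AutF2} (hf : IsNielsenReduced f) :
    f ∈ nielsen := by
  have hone : ∀ i, ∃ l, f⁻¹ (.of i) = .mk [l] := by
    intro i
    apply exists_eq_mk_of_norm_eq_one
    have h1 := hf.length_le (f⁻¹ (.of i))
    have h2 : (f⁻¹ (.of i)).norm ≠ 0 := by simp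
    simp only [MulAut.apply_inv_self, FreeGroup.norm_of] at h1
    omega
  obtain ⟨⟨i, s⟩, hl⟩ := hone 0
  obtain ⟨⟨j, t⟩, hm⟩ := hone 1
  have hne : ∀ e : F2, f⁻¹ (.of 0) = e → f⁻¹ (.of 1) ≠ e := fun e h0 h1 => by
    exact absurd (FreeGroup.of_injective (f⁻¹.injective (h0.trans h1.symm))) (by decide)
  have hne' : ∀ e : F2, f⁻¹ (.of 0) = e → f⁻¹ (.of 1) ≠ e⁻¹ := fun e h0 h1 => by
    rw [← h0, ← map_inv] at h1
    have := f⁻¹.injective h1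
    revert this
    decide
  have hstd : IsNielsenBasis (.of 0) (.of 1) := ⟨1, one_mem _, rfl, rfl⟩
  suffices IsNielsenBasis (f⁻¹ (.of 0)) (f⁻¹ (.of 1)) by
    obtain ⟨g, hg, h0, h1⟩ := this
    have : f⁻¹ = g := (aut_ext h0 h1).symm
    exact inv_mem_iff.1 (this ▸ hg)
  have hne1 := hne _ hl
  have hne2 := hne' _ hl
  rw [hm] at hne1 hne2
  rw [hl, hm]
  fin_cases i <;> fin_cases j <;> cases s <;> cases t <;>
    simp only [Fin.zero_eta, Fin.mk_one, mk_true, mk_false, inv_inv, ne_eq, not_true_eq_false]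
      at hne1 hne2 ⊢
  · exact hstd.inv_left.inv_right
  · exact hstd.inv_left
  · exact hstd.inv_right
  · exact hstd
  · exact hstd.inv_left.inv_right.swap
  · exact hstd.inv_right.swap
  · exact hstd.inv_left.swap
  · exact hstd.swap

theorem ne_one_of_isBasis {a b : F2} (h : IsBasis a b) : a ≠ 1 := by
  obtain ⟨f, rfl, rfl⟩ := h
  simp

/-- A basis which is not Nielsen reduced can be made shorter. -/
theorem isReducible_of_not_isNielsenReduced {f : AutF2} (hf : ¬ IsNielsenReduced f) :
    IsReducible (f (.of 0)) (f (.of 1)) := by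
  simp only [IsNielsenReduced, not_forall, not_lt] at hf
  obtain ⟨⟨m, t⟩, ⟨l, s⟩, ⟨r, u⟩, hm, hr, hle⟩ := hf
  have h : IsBasis (f (.of 0)) (f (.of 1)) := ⟨f, rfl, rfl⟩
  simp only [FreeGroup.isReduced_cons_cons] at hm hr
  have hm := hm.1
  have hr := hr.1
  -- the element `v` is the middle factor, and `c` is the other basis element
  have key : ∀ v c : F2, IsBasis c v → letterImage f (l, s) = v →
      (∀ i t, (i = l → s = t) → letterImage f (i, t) = c ∨ letterImage f (i, t) = c⁻¹ ∨
        letterImage f (i, t) = v) → IsReducible c v := by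
    intro v c hb hv hc
    refine .of_norm_le_com hb (ne_one_of_isBasis hb.swap) (hc m t fun h => (hm h).symm)
      (hc r u fun h => hr h.symm) ?_
    simpa only [hv] using hle
  fin_cases l <;> cases s
  · refine .swap (.of_inv_right (key _ _ h.swap.inv_right ?_ ?_)) <;>
      simp [letterImage, mk_true, mk_false, Fin.forall_fin_two]
  · refine .swap (key _ _ h.swap ?_ ?_) <;>
      simp [letterImage, mk_true, mk_false, Fin.forall_fin_two]
  · refine .of_inv_right (key _ _ h.inv_right ?_ ?_) <;>
      simp [letterImage, mk_true, mk_false, Fin.forall_fin_two]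
  · refine key _ _ h ?_ ?_ <;>
      simp [letterImage, mk_true, mk_false, Fin.forall_fin_two]

/-- **Nielsen's theorem** in rank two. -/
theorem IsBasis.isNielsenBasis {a b : F2} (h : IsBasis a b) : IsNielsenBasis a b := by
  induction hn : a.norm + b.norm using Nat.strong_induction_on generalizing a b with
  | _ n ih =>
    obtain ⟨f, rfl, rfl⟩ := h
    by_cases hf : IsNielsenReduced f
    · exact ⟨f, mem_nielsen_of_isNielsenReduced hf, rfl, rfl⟩
    · obtain ⟨a', b', h1, h2, h3⟩ := isReducible_of_not_isNielsenReduced hf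
      exact h2 (ih _ (hn ▸ h3) h1 rfl)

/-- To prove a property of all bases of the free group of rank two, it is enough to check it on the
standard basis, and to see that it is preserved by the elementary Nielsen moves. -/
@[elab_as_elim]
theorem IsBasis.induction {P : ∀ a b, IsBasis a b → Prop}
    (of_of : P (.of 0) (.of 1) .of_of)
    (swap : ∀ a b (h : IsBasis a b), P a b h → P b a h.swap)
    (inv : ∀ a b (h : IsBasis a b), P a b h → P a⁻¹ b h.inv_left)
    (mul : ∀ a b (h : IsBasis a b), P a b h → P (a * b) b h.mul_right)
    {a b : F2} (h : IsBasis a b) : P a b h := by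
  suffices ∃ h, P a b h from this.2
  obtain ⟨f, hf, rfl, rfl⟩ := h.isNielsenBasis
  clear h
  have inv' : ∀ a b (h : IsBasis a b), P a b h → P a b⁻¹ h.inv_right := fun a b h hP =>
    swap _ _ h.swap.inv_left (inv _ _ h.swap (swap _ _ h hP))
  induction hf using Subgroup.closure_induction_right with
  | one => exact ⟨_, of_of⟩
  | mul_right g hg s hs ih =>
    obtain ⟨h, ih⟩ := ih
    rcases hs with rfl | rfl | rfl
    · simpa using (⟨_, swap _ _ h ih⟩ : ∃ h, P _ _ h)
    · simpa using (⟨_, inv _ _ h ih⟩ : ∃ h, P _ _ h)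
    · simpa using (⟨_, mul _ _ h ih⟩ : ∃ h, P _ _ h)
  | mul_inv_cancel g hg s hs ih =>
    obtain ⟨h, ih⟩ := ih
    rcases hs with rfl | rfl | rfl
    · have : swapAut⁻¹ = swapAut := rfl
      simpa [this] using (⟨_, swap _ _ h ih⟩ : ∃ h, P _ _ h)
    · have : invAut⁻¹ = invAut := rfl
      simpa [this] using (⟨_, inv _ _ h ih⟩ : ∃ h, P _ _ h)
    · have h0 : mulAut⁻¹ (.of 0) = .of 0 * (.of 1)⁻¹ := by
        apply mulAut.injective; simp
      have h1 : mulAut⁻¹ (.of 1) = .of 1 := by apply mulAut.injective; simp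
      have := inv' _ _ _ (mul _ _ h.inv_right (inv' _ _ h ih))
      simpa [h0, h1] using (⟨_, this⟩ : ∃ h, P _ _ h)

/-! ### Vertices, edges and faces around a vertex -/

theorem frame_comm (a b : F2) : frame a b = frame b a := by
  ext w; simp only [frame, Set.mem_insert_iff, Set.mem_singleton_iff]; tauto

theorem frame_inv_left (a b : F2) : frame a⁻¹ b = frame a b := by
  ext w; simp only [frame, Set.mem_insert_iff, Set.mem_singleton_iff, inv_inv]; tauto

theorem frame_inv_right (a b : F2) : frame a b⁻¹ = frame a b := by
  rw [frame_comm, frame_inv_left, frame_comm]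

theorem image_frame (g : AutF2) (a b : F2) : g '' frame a b = frame (g a) (g b) := by
  simp [frame, Set.image_insert_eq]

/-- The ordered bases with a given underlying vertex differ by a signed permutation. -/
theorem eq_or_of_frame_eq {a b c d : F2} (h : IsBasis c d) (e : frame a b = frame c d) :
    ((c = a ∨ c = a⁻¹) ∧ (d = b ∨ d = b⁻¹)) ∨ ((c = b ∨ c = b⁻¹) ∧ (d = a ∨ d = a⁻¹)) := by
  have hc : c ∈ frame a b := e ▸ (by simp [frame])
  have hd : d ∈ frame a b := e ▸ (by simp [frame])
  have h1 : c ≠ d := by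
    obtain ⟨f, rfl, rfl⟩ := h
    exact fun h => absurd (f.injective h) (by decide)
  have h2 : c ≠ d⁻¹ := by
    obtain ⟨f, rfl, rfl⟩ := h
    rw [← map_inv]
    exact fun h => absurd (f.injective h) (by decide)
  simp only [frame, Set.mem_insert_iff, Set.mem_singleton_iff] at hc hd
  rcases hc with rfl | rfl | rfl | rfl <;> rcases hd with rfl | rfl | rfl | rfl <;> simp_all

/-- The vertex set of the triangle of `X` associated with a basis `(a, b)`. -/
def triangle (a b : F2) : Set (Set F2) := {frame a b, frame b (a * b), frame (a * b) a}

theorem triangle_rotate (a b : F2) : triangle b (a * b)⁻¹ = triangle a b := by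
  have h1 : frame (b * (a * b)⁻¹) b = frame a b := by simp [frame_inv_left]
  have h2 : frame (a * b)⁻¹ (b * (a * b)⁻¹) = frame (a * b) a := by
    rw [frame_inv_left]; simp [frame_inv_right]
  rw [triangle, triangle, h1, h2, frame_inv_right]
  ext; simp only [Set.mem_insert_iff, Set.mem_singleton_iff]; tauto

theorem triangle_inv (a b : F2) : triangle a⁻¹ b⁻¹ = triangle b a := by
  have h1 : a⁻¹ * b⁻¹ = (b * a)⁻¹ := by simp
  rw [triangle, triangle, h1]
  simp only [frame_inv_left, frame_inv_right]
  rw [frame_comm a b, frame_comm b (b * a), frame_comm a (b * a)]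
  ext; simp only [Set.mem_insert_iff, Set.mem_singleton_iff]; tauto

theorem lozenge_inv (a b : F2) : lozenge a⁻¹ b⁻¹ = lozenge a b := by
  have h1 : a⁻¹ * b⁻¹ = (b * a)⁻¹ := by simp
  have h2 : b⁻¹ * a⁻¹ * b⁻¹ = (b * a * b)⁻¹ := by simp [mul_assoc]
  have h3 : b⁻¹ * a⁻¹ = (a * b)⁻¹ := by simp
  rw [lozenge, lozenge, h2, h1, h3]
  simp only [frame_inv_left, frame_inv_right]
  ext; simp only [Set.mem_insert_iff, Set.mem_singleton_iff]; tauto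

theorem lozenge_rotate (a b : F2) : lozenge (b * a * b) b⁻¹ = lozenge a b := by
  have h1 : b * a * b * b⁻¹ = b * a := by simp
  have h2 : b⁻¹ * (b * a * b) = a * b := by group
  have h3 : a * b * b⁻¹ = a := by simp
  rw [lozenge, lozenge, h1, h2, h3]
  simp only [frame_inv_right]
  ext; simp only [Set.mem_insert_iff, Set.mem_singleton_iff]; tauto

/-- Bases giving the eight neighbors of the vertex `frame a b`. They are numbered in such a way that
the corners at `frame a b` of angle `π / 3` (triangles and small corners of lozenges, alternately)
join `i` to `i + 1` modulo 8, and the large corners of lozenges join `i` to `i + 4`. Thus, the link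
is a Moebius ladder, whose rungs are the large corners. -/
def nbrPair (a b : F2) : Fin 8 → F2 × F2 :=
  ![(a * b, b), (a⁻¹ * b, b), (a⁻¹ * b, a), (b * a, a), (b * a, b), (a * b⁻¹, b), (a * b⁻¹, a),
    (a * b, a)]

/-- The eight neighbors of the vertex `frame a b`. -/
def nbr (a b : F2) (i : Fin 8) : Set F2 := frame (nbrPair a b i).1 (nbrPair a b i).2

/-- Bases giving the twelve faces incident to the vertex `frame a b`: four triangles, then four
lozenges with a large angle at the vertex, then four lozenges with a small angle at the vertex. -/
def facePair (a b : F2) : Fin 12 → F2 × F2 :=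
  ![(a, b), (a⁻¹, b), (b, a), (a, b⁻¹),
    (a, b), (a⁻¹, b), (b⁻¹, a), (b, a),
    (b⁻¹ * a, b), (a⁻¹ * b, a), (a * b⁻¹, b), (b * a⁻¹, a)]

/-- The twelve faces incident to the vertex `frame a b`. -/
def face (a b : F2) (k : Fin 12) : Set (Set F2) :=
  if k < 4 then triangle (facePair a b k).1 (facePair a b k).2
  else lozenge (facePair a b k).1 (facePair a b k).2

/-- The two sides at the vertex `frame a b` of each of the faces incident to it. -/
def corner : Fin 12 → Finset (Fin 8) :=
  ![{0, 7}, {1, 2}, {3, 4}, {5, 6}, {0, 4}, {1, 5}, {2, 6}, {3, 7}, {0, 1}, {2, 3}, {4, 5}, {6, 7}]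

theorem image_nbr (g : AutF2) (a b : F2) (i : Fin 8) :
    g '' nbr a b i = nbr (g a) (g b) i := by
  rw [nbr, image_frame, nbr]
  congr 1 <;> fin_cases i <;> simp [nbrPair]

theorem image_lozenge (g : AutF2) (a b : F2) :
    (g '' ·) '' lozenge a b = lozenge (g a) (g b) := by
  simp [lozenge, Set.image_insert_eq, image_frame]

theorem image_triangle (g : AutF2) (a b : F2) :
    (g '' ·) '' triangle a b = triangle (g a) (g b) := by
  simp [triangle, Set.image_insert_eq, image_frame]

theorem image_face (g : AutF2) (a b : F2) (k : Fin 12) :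
    (g '' ·) '' face a b k = face (g a) (g b) k := by
  have h1 : g (facePair a b k).1 = (facePair (g a) (g b) k).1 := by
    fin_cases k <;> simp [facePair]
  have h2 : g (facePair a b k).2 = (facePair (g a) (g b) k).2 := by
    fin_cases k <;> simp [facePair]
  rw [face, face]
  split_ifs
  · rw [image_triangle, h1, h2]
  · rw [image_lozenge, h1, h2]

/-- Decidable version of `frame`. -/
def frameFinset (a b : F2) : Finset F2 := {a, a⁻¹, b, b⁻¹}

theorem coe_frameFinset (a b : F2) : (frameFinset a b : Set F2) = frame a b := by
  simp [frameFinset, frame]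

/-- Decidable version of `face`. -/
def faceFinset (a b : F2) (k : Fin 12) : Finset (Finset F2) :=
  let p := (facePair a b k).1
  let q := (facePair a b k).2
  if k < 4 then {frameFinset p q, frameFinset q (p * q), frameFinset (p * q) p}
  else {frameFinset p q, frameFinset (p * q) q, frameFinset (q * p * q) q, frameFinset (q * p) q}

theorem frame_mem_face_iff (a b p q : F2) (k : Fin 12) :
    frame p q ∈ face a b k ↔ frameFinset p q ∈ faceFinset a b k := by
  rw [face, faceFinset]
  split_ifs <;> simp [triangle, lozenge, ← coe_frameFinset]

theorem nbr_mem_face {a b : F2} (h : IsBasis a b) (i : Fin 8) (k : Fin 12) :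
    nbr a b i ∈ face a b k ↔ i ∈ corner k := by
  obtain ⟨f, rfl, rfl⟩ := h
  rw [← image_nbr, ← image_face,
    Set.InjOn.mem_image_iff (Set.image_injective.2 f.injective).injOn (Set.subset_univ _)
      (Set.mem_univ _), nbr, frame_mem_face_iff]
  revert i k
  decide +kernel

theorem frame_mem_face (a b : F2) (k : Fin 12) : frame a b ∈ face a b k := by
  fin_cases k <;>
    simp [face, facePair, triangle, lozenge, frame_inv_left, frame_inv_right, frame_comm b a]

theorem nbr_injective {a b : F2} (h : IsBasis a b) : Function.Injective (nbr a b) := by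
  intro i j hij
  have : ∀ k, i ∈ corner k ↔ j ∈ corner k := fun k => by
    rw [← nbr_mem_face h, ← nbr_mem_face h, hij]
  clear hij
  revert this
  revert i j
  decide +kernel

theorem face_injective {a b : F2} (h : IsBasis a b) : Function.Injective (face a b) := by
  intro k l hkl
  have : ∀ i, i ∈ corner k ↔ i ∈ corner l := fun i => by
    rw [← nbr_mem_face h, ← nbr_mem_face h, hkl]
  clear hkl
  revert this
  revert k l
  decide +kernel

theorem nbr_ne {a b : F2} (h : IsBasis a b) (i : Fin 8) : nbr a b i ≠ frame a b := by
  intro hi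
  have : ∀ k, i ∈ corner k := fun k => by
    rw [← nbr_mem_face h, hi]
    exact frame_mem_face a b k
  clear hi
  revert this
  revert i
  decide +kernel

theorem isEdge_nbr {a b : F2} (h : IsBasis a b) (i : Fin 8) :
    IsEdge {frame a b, nbr a b i} := by
  fin_cases i
  · exact ⟨a, b, h, rfl⟩
  · exact ⟨a⁻¹, b, h.inv_left, by simp [nbr, nbrPair, frame_inv_left]⟩
  · refine ⟨b⁻¹, a, h.swap.inv_left, ?_⟩
    rw [← frame_inv_left (b⁻¹ * a)]
    simp [nbr, nbrPair, frame_inv_left, frame_comm b a]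
  · exact ⟨b, a, h.swap, by simp [nbr, nbrPair, frame_comm b a]⟩
  · refine ⟨a⁻¹, b⁻¹, h.inv_left.inv_right, ?_⟩
    rw [← frame_inv_left (a⁻¹ * b⁻¹)]
    simp [nbr, nbrPair, frame_inv_left, frame_inv_right]
  · exact ⟨a, b⁻¹, h.inv_right, by simp [nbr, nbrPair, frame_inv_right]⟩
  · refine ⟨b, a⁻¹, h.swap.inv_right, ?_⟩
    rw [← frame_inv_left (b * a⁻¹)]
    simp [nbr, nbrPair, frame_inv_right, frame_comm b a]
  · refine ⟨b⁻¹, a⁻¹, h.swap.inv_right.inv_left, ?_⟩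
    rw [← frame_inv_left (b⁻¹ * a⁻¹)]
    simp [nbr, nbrPair, frame_inv_right, frame_inv_left, frame_comm b a]

theorem exists_nbr_of_isEdge {a b : F2} (h : IsBasis a b) {e : Set (Set F2)} (he : IsEdge e)
    (hv : frame a b ∈ e) : ∃ i, e = {frame a b, nbr a b i} := by
  have key : ∀ c d, IsBasis c d → frame a b = frame c d →
      ∃ i, ({frame c d, frame (c * d) d} : Set (Set F2)) = {frame a b, nbr a b i} := by
    intro c d hcd hv
    rw [← hv]
    suffices ∃ i, frame (c * d) d = nbr a b i by
      obtain ⟨i, hi⟩ := this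
      exact ⟨i, by rw [hi]⟩
    rcases eq_or_of_frame_eq hcd hv with ⟨rfl | rfl, rfl | rfl⟩ | ⟨rfl | rfl, rfl | rfl⟩
    · exact ⟨0, rfl⟩
    · exact ⟨5, frame_inv_right _ _⟩
    · exact ⟨1, rfl⟩
    · refine ⟨4, ?_⟩
      rw [← frame_inv_left (a⁻¹ * b⁻¹)]
      simp [nbr, nbrPair, frame_inv_right]
    · exact ⟨3, rfl⟩
    · refine ⟨6, ?_⟩
      rw [← frame_inv_left (c * a⁻¹)]
      simp [nbr, nbrPair, frame_inv_right]
    · refine ⟨2, ?_⟩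
      rw [← frame_inv_left (b⁻¹ * d)]
      simp [nbr, nbrPair]
    · refine ⟨7, ?_⟩
      rw [← frame_inv_left (b⁻¹ * a⁻¹)]
      simp [nbr, nbrPair, frame_inv_right]
  obtain ⟨c, d, hcd, rfl⟩ := he
  rcases hv with hv | hv
  · exact key c d hcd hv
  · -- the same edge, with its end points exchanged, comes from the basis `(c * d, d⁻¹)`
    obtain ⟨i, hi⟩ := key (c * d) d⁻¹ hcd.mul_right.inv_right (by rw [hv, frame_inv_right])
    refine ⟨i, ?_⟩
    rw [← hi, Set.pair_comm, frame_inv_right, frame_inv_right, mul_inv_cancel_right]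

theorem exists_face_of_isTriangle {a b : F2} (h : IsBasis a b) {t : Set (Set F2)}
    (ht : IsTriangle t) (hv : frame a b ∈ t) : ∃ k < 4, t = face a b k := by
  have key : ∀ c d, IsBasis c d → frame a b = frame c d → ∃ k < 4, triangle c d = face a b k := by
    intro c d hcd hv
    rcases eq_or_of_frame_eq hcd hv with ⟨rfl | rfl, rfl | rfl⟩ | ⟨rfl | rfl, rfl | rfl⟩
    · exact ⟨0, by decide, rfl⟩
    · exact ⟨3, by decide, rfl⟩
    · exact ⟨1, by decide, rfl⟩
    · exact ⟨2, by decide, triangle_inv a b⟩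
    · exact ⟨2, by decide, rfl⟩
    · refine ⟨3, by decide, ?_⟩
      rw [← inv_inv c, triangle_inv, inv_inv]; rfl
    · refine ⟨1, by decide, ?_⟩
      rw [← inv_inv d, triangle_inv, inv_inv]; rfl
    · exact ⟨0, by decide, triangle_inv b a⟩
  obtain ⟨c, d, hcd, rfl⟩ := ht
  change ∃ k < 4, triangle c d = _
  have h1 : IsBasis d (c * d)⁻¹ := hcd.mul_right.swap.inv_right
  have h2 : IsBasis (c * d)⁻¹ (d * (c * d)⁻¹)⁻¹ :=
    h1.mul_right.swap.inv_right
  rcases hv with hv | hv | hv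
  · exact key c d hcd hv
  · rw [← triangle_rotate]
    exact key _ _ h1 (by rw [hv, frame_inv_right])
  · rw [← triangle_rotate, ← triangle_rotate]
    refine key _ _ h2 ?_
    rw [hv, frame_inv_left]
    simp

/-! ### Alternating functions on bases -/

/-- Properties of bases which are invariant under inversions of basis elements, and which are turned
into their negation by exchanging the basis elements, and by transvections. -/
structure IsAlternating (ε : F2 → F2 → Prop) : Prop where
  swap : ∀ {a b}, IsBasis a b → (ε b a ↔ ¬ ε a b)
  inv_left : ∀ {a b}, IsBasis a b → (ε a⁻¹ b ↔ ε a b)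
  mul_right : ∀ {a b}, IsBasis a b → (ε (a * b) b ↔ ¬ ε a b)

namespace IsAlternating

variable {ε : F2 → F2 → Prop} {a b : F2}

theorem not (hε : IsAlternating ε) : IsAlternating fun a b => ¬ ε a b where
  swap h := not_congr (hε.swap h)
  inv_left h := not_congr (hε.inv_left h)
  mul_right h := not_congr (hε.mul_right h)

theorem inv_right (hε : IsAlternating ε) (h : IsBasis a b) : ε a b⁻¹ ↔ ε a b := by
  rw [hε.swap h.swap.inv_left, hε.inv_left h.swap, hε.swap h, not_not]

theorem mul_left (hε : IsAlternating ε) (h : IsBasis a b) : ε (b * a) b ↔ ¬ ε a b := by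
  rw [← hε.inv_left h.mul_left, ← hε.inv_right h.mul_left.inv_left, mul_inv_rev,
    hε.mul_right h.inv_left.inv_right, hε.inv_right h.inv_left, hε.inv_left h]

theorem mul_inv_right (hε : IsAlternating ε) (h : IsBasis a b) : ε (a * b⁻¹) b ↔ ¬ ε a b := by
  rw [← hε.inv_right h.mul_inv_right, hε.mul_right h.inv_right, hε.inv_right h]

theorem inv_mul_left (hε : IsAlternating ε) (h : IsBasis a b) : ε (b⁻¹ * a) b ↔ ¬ ε a b := by
  rw [← hε.inv_right h.inv_mul_left, hε.mul_left h.inv_right, hε.inv_right h]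

end IsAlternating

/-- Two bases define the same lozenge, and they cannot be told apart by an alternating function. -/
def SameLozenge (a b c d : F2) : Prop :=
  lozenge a b = lozenge c d ∧ ∀ ε, IsAlternating ε → (ε a b ↔ ε c d)

theorem SameLozenge.trans {a b c d p q : F2} (h : SameLozenge a b c d) (h' : SameLozenge c d p q) :
    SameLozenge a b p q :=
  ⟨h.1.trans h'.1, fun ε hε => (h.2 ε hε).trans (h'.2 ε hε)⟩

theorem SameLozenge.symm {a b c d : F2} (h : SameLozenge a b c d) : SameLozenge c d a b :=
  ⟨h.1.symm, fun ε hε => (h.2 ε hε).symm⟩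

theorem sameLozenge_inv {a b : F2} (h : IsBasis a b) : SameLozenge a⁻¹ b⁻¹ a b :=
  ⟨lozenge_inv a b, fun _ hε => by rw [hε.inv_right h.inv_left, hε.inv_left h]⟩

theorem sameLozenge_rotate {a b : F2} (h : IsBasis a b) : SameLozenge (b * a * b) b⁻¹ a b :=
  ⟨lozenge_rotate a b, fun _ hε => by
    rw [hε.inv_right h.mul_left.mul_right, hε.mul_right h.mul_left, hε.mul_left h, not_not]⟩

theorem exists_face_of_lozenge {a b c d : F2} (h : IsBasis a b) (hcd : IsBasis c d)
    (hv : frame a b ∈ lozenge c d) :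
    ∃ k, 4 ≤ k ∧ lozenge c d = face a b k ∧ ∀ ε, IsAlternating ε →
      (ε c d ↔ ε (facePair a b k).1 (facePair a b k).2) := by
  suffices ∃ k, 4 ≤ k ∧ SameLozenge c d (facePair a b k).1 (facePair a b k).2 by
    obtain ⟨k, hk, hs⟩ := this
    exact ⟨k, hk, by rw [face, if_neg hk.not_gt, hs.1], hs.2⟩
  have large : ∀ c d, IsBasis c d → frame a b = frame c d →
      ∃ k, 4 ≤ k ∧ SameLozenge c d (facePair a b k).1 (facePair a b k).2 := by
    intro c d hcd hv
    rcases eq_or_of_frame_eq hcd hv with ⟨rfl | rfl, rfl | rfl⟩ | ⟨rfl | rfl, rfl | rfl⟩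
    · exact ⟨4, by decide, rfl, fun _ _ => Iff.rfl⟩
    · refine ⟨5, by decide, ?_⟩
      simpa [facePair] using sameLozenge_inv h.inv_left
    · exact ⟨5, by decide, rfl, fun _ _ => Iff.rfl⟩
    · exact ⟨4, by decide, sameLozenge_inv h⟩
    · exact ⟨7, by decide, rfl, fun _ _ => Iff.rfl⟩
    · refine ⟨6, by decide, ?_⟩
      simpa [facePair] using sameLozenge_inv h.swap.inv_left
    · exact ⟨6, by decide, rfl, fun _ _ => Iff.rfl⟩
    · exact ⟨7, by decide, sameLozenge_inv h.swap⟩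
  have small' : ∀ a b, IsBasis a b → SameLozenge (a⁻¹ * b⁻¹) b (a * b⁻¹) b := by
    intro a b h
    have h1 := sameLozenge_inv h.mul_left.inv_right
    have h2 := sameLozenge_rotate h.mul_inv_right
    simp only [mul_inv_rev, inv_inv, mul_assoc, inv_mul_cancel, mul_one]
      at h1 h2
    exact h1.trans h2
  have small : ∀ c d, IsBasis c d → frame a b = frame c d →
      ∃ k, 4 ≤ k ∧ SameLozenge (c * d⁻¹) d (facePair a b k).1 (facePair a b k).2 := by
    intro c d hcd hv
    rcases eq_or_of_frame_eq hcd hv with ⟨rfl | rfl, rfl | rfl⟩ | ⟨rfl | rfl, rfl | rfl⟩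
    · exact ⟨10, by decide, rfl, fun _ _ => Iff.rfl⟩
    · refine ⟨8, by decide, ?_⟩
      simpa [facePair] using sameLozenge_rotate h.inv_mul_left
    · exact ⟨10, by decide, small' _ _ h⟩
    · refine ⟨8, by decide, ?_⟩
      simpa [facePair] using sameLozenge_inv h.inv_mul_left
    · exact ⟨11, by decide, rfl, fun _ _ => Iff.rfl⟩
    · refine ⟨9, by decide, ?_⟩
      simpa [facePair] using sameLozenge_rotate h.swap.inv_mul_left
    · exact ⟨11, by decide, small' _ _ h.swap⟩
    · refine ⟨9, by decide, ?_⟩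
      simpa [facePair] using sameLozenge_inv h.swap.inv_mul_left
  rcases hv with hv | hv | hv | hv
  · exact large c d hcd hv
  · simpa using small _ _ hcd.mul_right hv
  · obtain ⟨k, hk, hs⟩ := large _ _ hcd.mul_left.mul_right.inv_right (by rw [hv, frame_inv_right])
    exact ⟨k, hk, (sameLozenge_rotate hcd).symm.trans hs⟩
  · obtain ⟨k, hk, hs⟩ := small _ _ hcd.mul_left.inv_left.inv_right
      (by rw [hv, frame_inv_right, frame_inv_left])
    refine ⟨k, hk, (sameLozenge_inv hcd).symm.trans ?_⟩
    simpa using hs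

theorem exists_face_of_isFace {a b : F2} (h : IsBasis a b) {f : Set (Set F2)} (hf : IsFace f)
    (hv : frame a b ∈ f) : ∃ k, f = face a b k := by
  rcases hf with hf | ⟨c, d, hcd, rfl⟩
  · obtain ⟨k, -, hk⟩ := exists_face_of_isTriangle h hf hv
    exact ⟨k, hk⟩
  · obtain ⟨k, -, hk, -⟩ := exists_face_of_lozenge h hcd hv
    exact ⟨k, hk⟩

theorem not_isTriangle_lozenge {a b : F2} (h : IsBasis a b) : ¬ IsTriangle (lozenge a b) := by
  intro ht
  obtain ⟨k, hk, hkf⟩ := exists_face_of_isTriangle h ht (by simp [lozenge])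
  have : k = 4 := face_injective h (hkf.symm.trans rfl)
  exact absurd hk (by rw [this]; decide)

theorem isBasis_facePair {a b : F2} (h : IsBasis a b) (k : Fin 12) :
    IsBasis (facePair a b k).1 (facePair a b k).2 := by
  fin_cases k
  · exact h
  · exact h.inv_left
  · exact h.swap
  · exact h.inv_right
  · exact h
  · exact h.inv_left
  · exact h.swap.inv_left
  · exact h.swap
  · exact h.inv_mul_left
  · exact h.swap.inv_mul_left
  · exact h.mul_inv_right
  · exact h.swap.mul_inv_right

theorem isTriangle_face {a b : F2} (h : IsBasis a b) {k : Fin 12} (hk : k < 4) :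
    IsTriangle (face a b k) :=
  ⟨_, _, isBasis_facePair h k, by rw [face, if_pos hk]; rfl⟩

/-! ### Links of vertices -/

/-- The subgraph of the Moebius ladder whose edges are the corners satisfying `p`. -/
def cornerGraph (p : Fin 12 → Prop) : SimpleGraph (Fin 8) where
  Adj i j := i ≠ j ∧ ∃ k, p k ∧ i ∈ corner k ∧ j ∈ corner k
  symm := ⟨fun _ _ h => ⟨h.1.symm, h.2.imp fun _ hf => ⟨hf.1, hf.2.2, hf.2.1⟩⟩⟩
  loopless := ⟨fun _ h => h.1 rfl⟩

/-- The three corners incident to a vertex of the Moebius ladder. -/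
def incidentCorner : Fin 8 → Fin 3 → Fin 12 :=
  ![![0, 4, 8], ![1, 5, 8], ![1, 6, 9], ![2, 7, 9], ![2, 4, 10], ![3, 5, 10], ![3, 6, 11],
    ![0, 7, 11]]

/-- The three neighbors of a vertex in the Moebius ladder. -/
def opposite : Fin 8 → Fin 3 → Fin 8 :=
  ![![7, 4, 1], ![2, 5, 0], ![1, 6, 3], ![4, 7, 2], ![3, 0, 5], ![6, 1, 4], ![5, 2, 7], ![0, 3, 6]]

theorem opposite_injective (i : Fin 8) : Function.Injective (opposite i) := by
  revert i; decide +kernel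

theorem cornerGraph_adj_iff (p : Fin 12 → Prop) (i j : Fin 8) :
    (cornerGraph p).Adj i j ↔ ∃ t, p (incidentCorner i t) ∧ opposite i t = j := by
  have key : ∀ i j k, (i ≠ j ∧ i ∈ corner k ∧ j ∈ corner k) ↔
      ∃ t, incidentCorner i t = k ∧ opposite i t = j := by decide +kernel
  constructor
  · rintro ⟨hij, k, hk, hi, hj⟩
    obtain ⟨t, rfl, ht⟩ := (key i j k).1 ⟨hij, hi, hj⟩
    exact ⟨t, hk, ht⟩
  · rintro ⟨t, ht, rfl⟩
    obtain ⟨h1, h2, h3⟩ := (key i _ _).2 ⟨t, rfl, rfl⟩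
    exact ⟨h1, _, ht, h2, h3⟩

theorem ncard_neighborSet_cornerGraph (p : Fin 12 → Prop) (i : Fin 8) :
    ((cornerGraph p).neighborSet i).ncard = {t | p (incidentCorner i t)}.ncard := by
  rw [← Set.ncard_image_of_injective _ (opposite_injective i)]
  congr 1
  ext j
  simp [cornerGraph_adj_iff]

theorem exactly_two_of_ncard {q : Fin 3 → Prop} (h : {t | q t}.ncard = 2) :
    (¬ q 0 ∧ q 1 ∧ q 2) ∨ (q 0 ∧ ¬ q 1 ∧ q 2) ∨ (q 0 ∧ q 1 ∧ ¬ q 2) := by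
  classical
  have h' : ((Finset.univ : Finset (Fin 3)).filter q).card = 2 := by
    rw [← h, ← Set.ncard_coe_finset]
    congr 1
    ext; simp
  rw [Finset.card_filter, Fin.sum_univ_three] at h'
  split_ifs at h' <;> simp_all

/-- A subgraph of the Moebius ladder which is a circle omits one of the three edges at each
vertex. -/
theorem exactly_two_corners {p : Fin 12 → Prop} {n : ℕ} (hn : 3 ≤ n)
    (e : cornerGraph p ≃g SimpleGraph.cycleGraph n) (i : Fin 8) :
    (¬ p (incidentCorner i 0) ∧ p (incidentCorner i 1) ∧ p (incidentCorner i 2)) ∨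
    (p (incidentCorner i 0) ∧ ¬ p (incidentCorner i 1) ∧ p (incidentCorner i 2)) ∨
    (p (incidentCorner i 0) ∧ p (incidentCorner i 1) ∧ ¬ p (incidentCorner i 2)) := by
  apply exactly_two_of_ncard (q := fun t => p (incidentCorner i t))
  rw [← ncard_neighborSet_cornerGraph, ← Nat.card_coe_set_eq, Nat.card_congr (e.mapNeighborSet i)]
  obtain ⟨m, rfl⟩ := Nat.exists_eq_add_of_le' hn
  rw [Nat.card_eq_fintype_card, SimpleGraph.card_neighborSet_eq_degree,
    SimpleGraph.cycleGraph_degree_three_le]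

/-- A subgraph of the Moebius ladder which is a circle is not contained in the union of two disjoint
vertex sets. -/
theorem exists_corner_of_connected {p : Fin 12 → Prop} (h : (cornerGraph p).Connected)
    {A : Finset (Fin 8)} (h0 : 0 ∈ A) (h2 : 2 ∉ A) :
    ∃ k, p k ∧ ¬ corner k ⊆ A ∧ ¬ Disjoint (corner k) A := by
  by_contra! hA
  have key : ∀ i j, (cornerGraph p).Reachable i j → i ∈ A → j ∈ A := by
    rintro i j ⟨w⟩
    induction w with
    | nil => exact id
    | cons hadj _ ih =>
      intro hi
      obtain ⟨-, k, hk, hi', hj'⟩ := hadj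
      refine ih ?_
      by_cases hsub : corner k ⊆ A
      · exact hsub hj'
      · exact absurd hi (Finset.disjoint_left.1 (hA k hk hsub) hi')
  exact h2 (key 0 2 (h.preconnected 0 2) h0)

/-- The configuration of corners of the faces of a Hamiltonian surface at a vertex: each vertex
of the Moebius ladder is incident to two of them, and neither all triangles nor all small corners of
lozenges are omitted. -/
structure IsCircular (p : Fin 12 → Prop) : Prop where
  two : ∀ i, (¬ p (incidentCorner i 0) ∧ p (incidentCorner i 1) ∧ p (incidentCorner i 2)) ∨
    (p (incidentCorner i 0) ∧ ¬ p (incidentCorner i 1) ∧ p (incidentCorner i 2)) ∨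
    (p (incidentCorner i 0) ∧ p (incidentCorner i 1) ∧ ¬ p (incidentCorner i 2))
  triangle : p 0 ∨ p 1 ∨ p 2 ∨ p 3
  small : p 8 ∨ p 9 ∨ p 10 ∨ p 11

theorem isCircular_of_iso {p : Fin 12 → Prop} {n : ℕ} (hn : 3 ≤ n)
    (e : cornerGraph p ≃g SimpleGraph.cycleGraph n) : IsCircular p := by
  have hc : (cornerGraph p).Connected := by
    obtain ⟨m, rfl⟩ := Nat.exists_eq_add_of_le' hn
    exact e.connected_iff.2 SimpleGraph.cycleGraph_connected
  refine ⟨exactly_two_corners hn e, ?_, ?_⟩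
  · obtain ⟨k, hk, hk'⟩ := exists_corner_of_connected hc (A := {0, 1, 4, 5}) (by decide) (by decide)
    have : k = 0 ∨ k = 1 ∨ k = 2 ∨ k = 3 := by
      revert hk'; clear hk; revert k; decide +kernel
    rcases this with rfl | rfl | rfl | rfl <;> simp [hk]
  · obtain ⟨k, hk, hk'⟩ := exists_corner_of_connected hc (A := {0, 3, 4, 7}) (by decide) (by decide)
    have : k = 8 ∨ k = 9 ∨ k = 10 ∨ k = 11 := by
      revert hk'; clear hk; revert k; decide +kernel
    rcases this with rfl | rfl | rfl | rfl <;> simp [hk]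

namespace IsCircular

variable {p : Fin 12 → Prop}

/-- If the small corner joining 0 to 1 is omitted, then so is the large corner joining 3 to 7. -/
theorem not_large_of_not_small (h : IsCircular p) (h8 : ¬ p 8) : ¬ p 7 := by
  have := h.two
  have := h.small
  simp [Fin.forall_fin_succ, incidentCorner] at *
  grind

/-- If the small corner joining 4 to 5 is omitted, then so is the large corner joining 2 to 6. -/
theorem not_large_of_not_small' (h : IsCircular p) (h10 : ¬ p 10) : ¬ p 6 := by
  have := h.two
  have := h.small
  simp [Fin.forall_fin_succ, incidentCorner] at *
  grind

/-- The small corner joining 2 to 3 and the large corner joining 3 to 7 are not both omitted. -/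
theorem large_of_not_small (h : IsCircular p) (h9 : ¬ p 9) : p 7 := by
  have := h.two 3
  simp [incidentCorner] at this
  grind

/-- If the rungs joining 0 to 4 and 3 to 7, respectively 1 to 5 and 2 to 6, are not both omitted,
then there are only two configurations: no triangle is omitted, and two rungs in the same plane
are. -/
theorem cases (h : IsCircular p) (h47 : p 4 ∨ p 7) (h56 : p 5 ∨ p 6) :
    (p 0 ∧ p 1 ∧ p 2 ∧ p 3) ∧ (p 5 ↔ p 4) ∧ (p 7 ↔ ¬ p 4) ∧ (p 4 ↔ ¬ p 10) := by
  have := h.two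
  have := h.small
  have := h.triangle
  simp [Fin.forall_fin_succ, incidentCorner] at *
  grind

end IsCircular

theorem isVertex_of_mem_of_isEdge {e : Set (Set F2)} (he : IsEdge e) {v : Set F2} (hv : v ∈ e) :
    IsVertex v := by
  obtain ⟨a, b, h, rfl⟩ := he
  rcases hv with rfl | rfl
  · exact ⟨a, b, h, rfl⟩
  · exact ⟨a * b, b, h.mul_right, rfl⟩

namespace Subcomplex

variable {S : Subcomplex} {a b : F2}

/-- The edges at `frame a b` of a subcomplex which contains all of them, numbered from 0 to 7. -/
noncomputable def linkEquiv (hS : ∀ e, IsEdge e → e ∈ S.edges) (h : IsBasis a b) :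
    Fin 8 ≃ {e : Set (Set F2) // e ∈ S.edges ∧ frame a b ∈ e} :=
  Equiv.ofBijective (fun i => ⟨{frame a b, nbr a b i}, hS _ (isEdge_nbr h i), by simp⟩) <| by
    constructor
    · intro i j hij
      have : nbr a b i ∈ ({frame a b, nbr a b j} : Set (Set F2)) := by
        rw [← Subtype.mk.inj hij]; simp
      exact nbr_injective h (this.resolve_left (nbr_ne h i))
    · rintro ⟨e, he, hv⟩
      obtain ⟨i, rfl⟩ := exists_nbr_of_isEdge h (S.isEdge_of_mem e he) hv
      exact ⟨i, rfl⟩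

/-- The link of the vertex `frame a b` is a subgraph of the Moebius ladder. -/
noncomputable def linkIso (hS : ∀ e, IsEdge e → e ∈ S.edges) (h : IsBasis a b) :
    cornerGraph (fun k => face a b k ∈ S.faces) ≃g S.link (frame a b) where
  toEquiv := linkEquiv hS h
  map_rel_iff' := by
    intro i j
    have hsub : ∀ i k, ({frame a b, nbr a b i} : Set (Set F2)) ⊆ face a b k ↔ i ∈ corner k := by
      intro i k
      rw [Set.pair_subset_iff, nbr_mem_face h]
      exact and_iff_right (frame_mem_face a b k)
    change (linkEquiv hS h i ≠ linkEquiv hS h j ∧ ∃ f ∈ S.faces,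
      ({frame a b, nbr a b i} : Set (Set F2)) ⊆ f ∧ {frame a b, nbr a b j} ⊆ f) ↔
      (i ≠ j ∧ ∃ k, face a b k ∈ S.faces ∧ i ∈ corner k ∧ j ∈ corner k)
    rw [(linkEquiv hS h).injective.ne_iff]
    refine and_congr_right fun _ => ⟨?_, ?_⟩
    · rintro ⟨f, hf, hi, hj⟩
      obtain ⟨k, rfl⟩ := exists_face_of_isFace h (S.isFace_of_mem f hf) (hi (by simp))
      exact ⟨k, hf, (hsub i k).1 hi, (hsub j k).1 hj⟩
    · rintro ⟨k, hk, hi, hj⟩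
      exact ⟨_, hk, (hsub i k).2 hi, (hsub j k).2 hj⟩

/-! ### Hamiltonian surfaces are determined by alternating functions -/

namespace IsHamiltonianSurface

theorem isCircular (hS : S.IsHamiltonianSurface) (h : IsBasis a b) :
    IsCircular fun k => face a b k ∈ S.faces := by
  obtain ⟨n, hn, ⟨e⟩⟩ := hS.1.2 _ (hS.2.1 _ ⟨a, b, h, rfl⟩)
  exact isCircular_of_iso hn ((linkIso hS.2.2 h).trans e)

/-- If the lozenges of `(a, b)` and of `(b, a)` were both omitted, then so would be two small
corners at the vertex `frame (a * b) a`, in distinct planes. -/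
theorem lozenge_mem_or (hS : S.IsHamiltonianSurface) (h : IsBasis a b) :
    lozenge a b ∈ S.faces ∨ lozenge b a ∈ S.faces := by
  by_contra! hab
  have h1 : lozenge b⁻¹ (a * b) ∉ S.faces := by
    have := (hS.isCircular h.mul_right).not_large_of_not_small'
    simp only [show face (a * b) b 10 = lozenge (a * b * b⁻¹) b from rfl,
      show face (a * b) b 6 = lozenge b⁻¹ (a * b) from rfl, mul_inv_cancel_right] at this
    exact this hab.1
  have hc := hS.isCircular h.swap.mul_left
  have h8 := hc.not_large_of_not_small
  have h9 := hc.large_of_not_small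
  simp only [show face (a * b) a 8 = lozenge (a⁻¹ * (a * b)) a from rfl,
    show face (a * b) a 9 = lozenge ((a * b)⁻¹ * a) (a * b) from rfl,
    show (a * b)⁻¹ * a = b⁻¹ by group, inv_mul_cancel_left] at h8 h9
  exact h8 hab.2 (h9 h1)

theorem cases (hS : S.IsHamiltonianSurface) (h : IsBasis a b) :
    triangle a b ∈ S.faces ∧ (lozenge a⁻¹ b ∈ S.faces ↔ lozenge a b ∈ S.faces) ∧
      (lozenge b a ∈ S.faces ↔ lozenge a b ∉ S.faces) ∧
      (lozenge a b ∈ S.faces ↔ lozenge (a * b⁻¹) b ∉ S.faces) := by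
  have h56 := hS.lozenge_mem_or h.inv_left
  rw [← lozenge_inv b, inv_inv] at h56
  obtain ⟨h1, h2, h3, h4⟩ := (hS.isCircular h).cases (hS.lozenge_mem_or h) h56
  exact ⟨h1.1, h2, h3, h4⟩

theorem isAlternating (hS : S.IsHamiltonianSurface) :
    IsAlternating fun a b => lozenge a b ∈ S.faces where
  swap h := (hS.cases h).2.2.1
  inv_left h := (hS.cases h).2.1
  mul_right {a b} h := by simpa using (hS.cases h.mul_right).2.2.2

end IsHamiltonianSurface

end Subcomplex

/-- The subcomplex which consists of all vertices, edges and triangles, and of the lozenges of the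
bases satisfying `ε`. -/
def surface (ε : F2 → F2 → Prop) : Subcomplex where
  verts := {v | IsVertex v}
  edges := {e | IsEdge e}
  faces := {f | IsTriangle f ∨ ∃ a b, IsBasis a b ∧ ε a b ∧ f = lozenge a b}
  isVertex_of_mem _ hv := hv
  isEdge_of_mem _ he := he
  isFace_of_mem _ hf := hf.imp_right fun ⟨a, b, h, _, hf⟩ => ⟨a, b, h, hf⟩
  endpoint_mem _ he _ hv := isVertex_of_mem_of_isEdge he hv
  boundary_mem _ _ _ he _ := he

theorem surface_congr {ε ε' : F2 → F2 → Prop} (h : ∀ a b, IsBasis a b → (ε a b ↔ ε' a b)) :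
    surface ε = surface ε' := by
  ext
  · rfl
  · rfl
  · refine or_congr_right (exists_congr fun a => exists_congr fun b => ?_)
    exact and_congr_right fun hab => and_congr_left fun _ => h a b hab

theorem Subcomplex.IsHamiltonianSurface.eq_surface {S : Subcomplex} (hS : S.IsHamiltonianSurface) :
    S = surface fun a b => lozenge a b ∈ S.faces := by
  ext f
  · exact ⟨S.isVertex_of_mem f, hS.2.1 f⟩
  · exact ⟨S.isEdge_of_mem f, hS.2.2 f⟩
  · constructor
    · intro hf
      rcases S.isFace_of_mem f hf with ht | ⟨a, b, h, rfl⟩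
      · exact Or.inl ht
      · exact Or.inr ⟨a, b, h, hf, rfl⟩
    · rintro (⟨a, b, h, rfl⟩ | ⟨a, b, h, hf, rfl⟩)
      · exact (hS.cases h).1
      · exact hf

/-- Nielsen's theorem implies that an alternating function is determined by its value at the
standard basis. -/
theorem IsAlternating.iff_of_iff {ε ε' : F2 → F2 → Prop} (hε : IsAlternating ε)
    (hε' : IsAlternating ε') (h0 : ε (.of 0) (.of 1) ↔ ε' (.of 0) (.of 1)) {a b : F2}
    (h : IsBasis a b) : ε a b ↔ ε' a b := by
  induction h using IsBasis.induction with
  | of_of => exact h0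
  | swap a b h ih => rw [hε.swap h, hε'.swap h, ih]
  | inv a b h ih => rw [hε.inv_left h, hε'.inv_left h, ih]
  | mul a b h ih => rw [hε.mul_right h, hε'.mul_right h, ih]

/-! ### Alternating functions define Hamiltonian surfaces -/

section Surface

variable {ε : F2 → F2 → Prop} {a b : F2}

theorem lozenge_mem_surface_iff (hε : IsAlternating ε) (h : IsBasis a b) :
    lozenge a b ∈ (surface ε).faces ↔ ε a b := by
  constructor
  · rintro (ht | ⟨c, d, hcd, hc, he⟩)
    · exact absurd ht (not_isTriangle_lozenge h)
    · obtain ⟨k, -, hk, hk'⟩ := exists_face_of_lozenge h hcd (he ▸ by simp [lozenge])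
      have : k = 4 := face_injective h ((hk.symm.trans he.symm).trans rfl)
      subst this
      exact (hk' ε hε).1 hc
  · exact fun hab => Or.inr ⟨a, b, h, hab, rfl⟩

theorem face_mem_surface_iff (hε : IsAlternating ε) (h : IsBasis a b) (hab : ε a b) (k : Fin 12) :
    face a b k ∈ (surface ε).faces ↔ k ∈ ({0, 1, 2, 3, 4, 5, 9, 11} : Finset (Fin 12)) := by
  by_cases hk : k < 4
  · refine iff_of_true (Or.inl (isTriangle_face h hk)) ?_
    revert k; decide +kernel
  · have hs := hε.swap h
    have h4 : face a b k = lozenge (facePair a b k).1 (facePair a b k).2 := by rw [face, if_neg hk]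
    rw [h4, lozenge_mem_surface_iff hε (isBasis_facePair h k)]
    fin_cases k <;> simp [facePair, hab, hs, hε.inv_left h, hε.inv_left h.swap,
      hε.inv_mul_left h, hε.inv_mul_left h.swap, hε.mul_inv_right h,
      hε.mul_inv_right h.swap] at hk ⊢

/-- The cyclic order of the edges around a vertex `frame a b` of `surface ε`, if `ε a b` holds. -/
def cyclicOrder : Fin 8 ≃ Fin 8 where
  toFun := ![0, 4, 3, 2, 1, 5, 6, 7]
  invFun := ![0, 4, 3, 2, 1, 5, 6, 7]
  left_inv := by decide
  right_inv := by decide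

/-- In the cyclic order of `cyclicOrder`, the corners of the faces of `surface ε` form an 8-cycle.
-/
def cycleIso :
    SimpleGraph.cycleGraph 8 ≃g
      cornerGraph (fun k => k ∈ ({0, 1, 2, 3, 4, 5, 9, 11} : Finset (Fin 12))) where
  toEquiv := cyclicOrder
  map_rel_iff' := by
    intro i j
    simp only [cornerGraph]
    revert i j
    decide +kernel

theorem link_surface (hε : IsAlternating ε) (h : IsBasis a b) (hab : ε a b) :
    Nonempty ((surface ε).link (frame a b) ≃g SimpleGraph.cycleGraph 8) := by
  have e := Subcomplex.linkIso (S := surface ε) (fun _ he => he) h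
  have hp : (fun k => face a b k ∈ (surface ε).faces) =
      fun k => k ∈ ({0, 1, 2, 3, 4, 5, 9, 11} : Finset (Fin 12)) := by
    funext k
    exact propext (face_mem_surface_iff hε h hab k)
  rw [hp] at e
  exact ⟨e.symm.trans cycleIso.symm⟩

theorem connected_skeleton_surface (ε : F2 → F2 → Prop) : (surface ε).skeleton.Connected := by
  have hv {a b : F2} (h : IsBasis a b) : frame a b ∈ (surface ε).verts := ⟨a, b, h, rfl⟩
  have key : ∀ {a b : F2} (h : IsBasis a b),
      (surface ε).skeleton.Reachable ⟨_, hv .of_of⟩ ⟨_, hv h⟩ := by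
    intro a b h
    induction h using IsBasis.induction with
    | of_of => exact .rfl
    | swap a b h ih => simpa only [frame_comm b a] using ih
    | inv a b h ih => simpa only [frame_inv_left] using ih
    | mul a b h ih =>
      refine ih.trans (SimpleGraph.Adj.reachable ⟨?_, ⟨a, b, h, rfl⟩⟩)
      exact fun he => nbr_ne h 0 (Subtype.mk.inj he).symm
  have : Nonempty (surface ε).verts := ⟨⟨_, hv .of_of⟩⟩
  refine ⟨?_⟩
  rintro ⟨_, a, b, h, rfl⟩ ⟨_, c, d, h', rfl⟩
  exact (key h).symm.trans (key h')

theorem isHamiltonianSurface_surface (hε : IsAlternating ε) :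
    (surface ε).IsHamiltonianSurface := by
  refine ⟨⟨connected_skeleton_surface ε, ?_⟩, fun _ hv => hv, fun _ he => he⟩
  rintro _ ⟨a, b, h, rfl⟩
  refine ⟨8, by norm_num, ?_⟩
  by_cases hab : ε a b
  · exact link_surface hε h hab
  · rw [frame_comm]
    exact link_surface hε h.swap ((hε.swap h).2 hab)

end Surface

/-! ### The alternating function defined by the reduction modulo 2 -/

/-- Reduction modulo 2 of the abelianization. -/
def modTwo : F2 →* Multiplicative (ZMod 2 × ZMod 2) :=
  FreeGroup.lift ![.ofAdd (1, 0), .ofAdd (0, 1)]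

/-- The rotation of order 3 of the three nonzero vectors of a plane over `ZMod 2`. -/
def rotation (u : Multiplicative (ZMod 2 × ZMod 2)) : Multiplicative (ZMod 2 × ZMod 2) :=
  .ofAdd (u.toAdd.2, u.toAdd.1 + u.toAdd.2)

/-- The basis `(a, b)` is positive if its reduction modulo 2 agrees with the cyclic order of the
three nonzero vectors, i.e. if it defines an even permutation of these vectors. -/
def IsPositive (a b : F2) : Prop := modTwo b = rotation (modTwo a)

theorem isPositive_of_of : IsPositive (.of 0) (.of 1) := by
  simp only [IsPositive, modTwo, FreeGroup.lift_apply_of]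
  decide

theorem modTwo_ne {a b : F2} (h : IsBasis a b) :
    modTwo a ≠ 1 ∧ modTwo b ≠ 1 ∧ modTwo a ≠ modTwo b := by
  induction h using IsBasis.induction with
  | of_of =>
    simp only [modTwo, FreeGroup.lift_apply_of]
    decide
  | swap a b h ih => exact ⟨ih.2.1, ih.1, ih.2.2.symm⟩
  | inv a b h ih =>
    rw [map_inv]
    revert ih
    generalize modTwo a = u
    generalize modTwo b = v
    revert u v
    decide +kernel
  | mul a b h ih =>
    rw [map_mul]
    revert ih
    generalize modTwo a = u
    generalize modTwo b = v
    revert u v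
    decide +kernel

theorem isAlternating_isPositive : IsAlternating IsPositive where
  swap {a b} h := by
    have := modTwo_ne h
    revert this
    rw [IsPositive, IsPositive]
    generalize modTwo a = u
    generalize modTwo b = v
    revert u v
    decide +kernel
  inv_left {a b} h := by
    have := modTwo_ne h
    revert this
    rw [IsPositive, IsPositive, map_inv]
    generalize modTwo a = u
    generalize modTwo b = v
    revert u v
    decide +kernel
  mul_right {a b} h := by
    have := modTwo_ne h
    revert this
    rw [IsPositive, IsPositive, map_mul]
    generalize modTwo a = u
    generalize modTwo b = v
    revert u v
    decide +kernel

theorem IsAlternating.isPositive_or {ε : F2 → F2 → Prop} (hε : IsAlternating ε) :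
    (∀ a b, IsBasis a b → (ε a b ↔ IsPositive a b)) ∨
      ∀ a b, IsBasis a b → (ε a b ↔ ¬ IsPositive a b) := by
  by_cases h0 : ε (.of 0) (.of 1)
  · exact Or.inl fun a b h => hε.iff_of_iff isAlternating_isPositive
      (iff_of_true h0 isPositive_of_of) h
  · exact Or.inr fun a b h => hε.iff_of_iff isAlternating_isPositive.not
      (iff_of_false h0 (not_not.2 isPositive_of_of)) h

theorem isHamiltonianSurface_iff {S : Subcomplex} :
    S.IsHamiltonianSurface ↔ S = surface IsPositive ∨ S = surface fun a b => ¬ IsPositive a b := by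
  constructor
  · intro hS
    rw [hS.eq_surface]
    exact hS.isAlternating.isPositive_or.imp surface_congr surface_congr
  · rintro (rfl | rfl)
    · exact isHamiltonianSurface_surface isAlternating_isPositive
    · exact isHamiltonianSurface_surface isAlternating_isPositive.not

theorem surface_isPositive_ne : surface IsPositive ≠ surface fun a b => ¬ IsPositive a b := by
  intro h
  have h1 := (lozenge_mem_surface_iff isAlternating_isPositive .of_of).2 isPositive_of_of
  rw [h, lozenge_mem_surface_iff isAlternating_isPositive.not .of_of] at h1
  exact h1 isPositive_of_of

theorem ncard_isHamiltonianSurface : {S : Subcomplex | S.IsHamiltonianSurface}.ncard = 2 := by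
  rw [← Set.ncard_pair surface_isPositive_ne]
  congr 1
  ext S
  exact isHamiltonianSurface_iff

/-! ### Functoriality of the geometric realization -/

theorem image_vertex_injective (g : AutF2) : Function.Injective fun v : Set F2 => g '' v :=
  Set.image_injective.2 g.injective

theorem act_act_inv (g : AutF2) (p : Coord) : act g (act g⁻¹ p) = p := by
  have : (fun v : Set F2 => g '' v) ∘ (fun v : Set F2 => (g⁻¹ : AutF2) '' v) = id := by
    funext v; simp [Set.image_image]
  rw [act, act, ← Finsupp.mapDomain_comp, this, Finsupp.mapDomain_id]

theorem act_inv_act (g : AutF2) (p : Coord) : act g⁻¹ (act g p) = p := by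
  simpa using act_act_inv g⁻¹ p

theorem act_mul (g h : AutF2) (p : Coord) : act (g * h) p = act g (act h p) := by
  rw [act, act, act, ← Finsupp.mapDomain_comp]
  congr 1
  funext v
  simp [Set.image_image]

/-- The image of a set of vertices under an automorphism. -/
def imageVertices (g : AutF2) (s : Set (Set F2)) : Set (Set F2) := (g '' ·) '' s

theorem imageVertices_imageVertices_inv (g : AutF2) (s : Set (Set F2)) :
    imageVertices g (imageVertices g⁻¹ s) = s := by
  simp [imageVertices, Set.image_image]

theorem act_mem_closedSimplex {g : AutF2} {s : Set (Set F2)} {p : Coord}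
    (hp : p ∈ closedSimplex s) : act g p ∈ closedSimplex (imageVertices g s) := by
  obtain ⟨h1, h2, h3⟩ := hp
  refine ⟨fun v => ?_, ?_, ?_⟩
  · by_cases hv : v ∈ Set.range fun v : Set F2 => g '' v
    · obtain ⟨w, rfl⟩ := hv
      rw [act, Finsupp.mapDomain_apply (image_vertex_injective g)]
      exact h1 w
    · rw [act, Finsupp.mapDomain_of_notMem_range _ _ hv]
  · rw [act, Finsupp.sum_mapDomain_index_inj (image_vertex_injective g)]
    exact h2
  · classical
    rw [act, Finsupp.mapDomain_support_of_injective (image_vertex_injective g), Finset.coe_image]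
    exact Set.image_mono h3

/-- If every automorphism maps each member of a family `C` into the corresponding member, then it
maps it onto that member, as one sees by applying the inverse automorphism. -/
theorem image_act_eq_of_mapsTo {C : Set (Set F2) → Set Coord}
    (hC : ∀ g s p, p ∈ C s → act g p ∈ C (imageVertices g s)) (g : AutF2) (s : Set (Set F2)) :
    act g '' C s = C (imageVertices g s) := by
  refine Set.Subset.antisymm (Set.image_subset_iff.2 fun p hp => hC g s p hp) fun p hp => ?_
  refine ⟨act g⁻¹ p, ?_, act_act_inv g p⟩
  have := hC g⁻¹ _ p hp
  have h := imageVertices_imageVertices_inv g⁻¹ s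
  rw [inv_inv] at h
  rwa [h] at this

theorem image_act_closedSimplex (g : AutF2) (s : Set (Set F2)) :
    act g '' closedSimplex s = closedSimplex (imageVertices g s) :=
  image_act_eq_of_mapsTo (fun _ _ _ => act_mem_closedSimplex) g s

theorem simplexDist_act (g : AutF2) (p q : Coord) :
    simplexDist (act g p) (act g q) = simplexDist p q := by
  have h : act g p - act g q = act g (p - q) :=
    (map_sub (Finsupp.mapDomain.addMonoidHom fun v : Set F2 => g '' v) p q).symm
  rw [simplexDist, h, act, Finsupp.sum_mapDomain_index_inj (image_vertex_injective g), simplexDist]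

theorem IsEdge.imageVertices {e : Set (Set F2)} (he : IsEdge e) (g : AutF2) :
    IsEdge (imageVertices g e) := by
  obtain ⟨a, b, h, rfl⟩ := he
  exact ⟨g a, g b, h.map g, by simp [Brady.imageVertices, Set.image_insert_eq, image_frame]⟩

theorem IsVertex.image {v : Set F2} (hv : IsVertex v) (g : AutF2) : IsVertex (g '' v) := by
  obtain ⟨a, b, h, rfl⟩ := hv
  exact ⟨g a, g b, h.map g, image_frame g a b⟩

theorem IsTriangle.imageVertices {t : Set (Set F2)} (ht : IsTriangle t) (g : AutF2) :
    IsTriangle (imageVertices g t) := by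
  obtain ⟨a, b, h, rfl⟩ := ht
  exact ⟨g a, g b, h.map g, image_triangle g a b⟩

theorem IsLozenge.imageVertices {l : Set (Set F2)} (hl : IsLozenge l) (g : AutF2) :
    IsLozenge (imageVertices g l) := by
  obtain ⟨a, b, h, rfl⟩ := hl
  exact ⟨g a, g b, h.map g, image_lozenge g a b⟩

theorem imageVertices_mem_pieces {f s : Set (Set F2)} (hs : s ∈ pieces f) (g : AutF2) :
    imageVertices g s ∈ pieces (imageVertices g f) := by
  rcases hs with ⟨hf, rfl⟩ | ⟨a, b, h, rfl, hs⟩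
  · exact Or.inl ⟨hf.imageVertices g, rfl⟩
  · refine Or.inr ⟨g a, g b, h.map g, image_lozenge g a b, ?_⟩
    rcases hs with rfl | rfl
    · exact Or.inl (by simp [imageVertices, Set.image_insert_eq, image_frame])
    · exact Or.inr (by simp [imageVertices, Set.image_insert_eq, image_frame])

theorem image_act_closedFace (g : AutF2) (f : Set (Set F2)) :
    act g '' closedFace f = closedFace (imageVertices g f) := by
  refine image_act_eq_of_mapsTo (fun g f p hp => ?_) g f
  obtain ⟨s, hs, hp⟩ := Set.mem_iUnion₂.1 hp
  exact Set.mem_iUnion₂.2 ⟨_, imageVertices_mem_pieces hs g, act_mem_closedSimplex hp⟩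

namespace Subcomplex

/-- The automorphism `g` maps the subcomplex `S` into the subcomplex `T`. -/
structure MapsInto (g : AutF2) (S T : Subcomplex) : Prop where
  verts : ∀ v ∈ S.verts, g '' v ∈ T.verts
  edges : ∀ e ∈ S.edges, imageVertices g e ∈ T.edges
  faces : ∀ f ∈ S.faces, imageVertices g f ∈ T.faces

namespace MapsInto

variable {g : AutF2} {S T : Subcomplex}

theorem simplices (h : MapsInto g S T) {s : Set (Set F2)} (hs : s ∈ S.simplices) :
    imageVertices g s ∈ T.simplices := by
  rcases hs with ⟨v, hv, rfl⟩ | he | ⟨f, hf, hs⟩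
  · exact Or.inl ⟨_, h.verts v hv, by simp [imageVertices]⟩
  · exact Or.inr (Or.inl (h.edges _ he))
  · exact Or.inr (Or.inr ⟨_, h.faces f hf, imageVertices_mem_pieces hs g⟩)

theorem act_mem (h : MapsInto g S T) {p : Coord} (hp : p ∈ S.realization) :
    act g p ∈ T.realization := by
  obtain ⟨s, hs, hp⟩ := Set.mem_iUnion₂.1 hp
  exact Set.mem_iUnion₂.2 ⟨_, h.simplices hs, act_mem_closedSimplex hp⟩

theorem isString (h : MapsInto g S T) {n : ℕ} {x : ℕ → Coord} (hx : S.IsString n x) :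
    T.IsString n fun i => act g (x i) := by
  intro i hi
  obtain ⟨s, hs, h1, h2⟩ := hx i hi
  exact ⟨_, h.simplices hs, act_mem_closedSimplex h1, act_mem_closedSimplex h2⟩

theorem pathDist_le (h : MapsInto g S T) (p q : S.realization) (p' q' : T.realization)
    (hp : (p' : Coord) = act g p) (hq : (q' : Coord) = act g q) :
    T.pathDist p' q' ≤ S.pathDist p q := by
  refine le_iInf fun n => le_iInf fun x => le_iInf fun hx => le_iInf fun h0 => le_iInf fun hn => ?_
  refine (iInf_le _ n).trans <| (iInf_le _ fun i => act g (x i)).trans <|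
    (iInf_le _ (h.isString hx)).trans <| (iInf_le _ (by simp only [h0, hp])).trans <|
    (iInf_le _ (by simp only [hn, hq])).trans ?_
  simp only [simplexDist_act, le_refl]

/-- An automorphism carrying `S` onto `T` defines a bijection of their realizations. -/
noncomputable def realizationEquiv (h : MapsInto g S T) (h' : MapsInto g⁻¹ T S) :
    S.realization ≃ T.realization where
  toFun p := ⟨act g p, h.act_mem p.2⟩
  invFun p := ⟨act g⁻¹ p, h'.act_mem p.2⟩
  left_inv p := Subtype.ext (act_inv_act g p)
  right_inv p := Subtype.ext (act_act_inv g p)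

theorem image_act_realization (h : MapsInto g S T) (h' : MapsInto g⁻¹ T S) :
    act g '' S.realization = T.realization := by
  refine Set.Subset.antisymm (Set.image_subset_iff.2 fun p hp => h.act_mem hp) fun p hp => ?_
  exact ⟨act g⁻¹ p, h'.act_mem hp, act_act_inv g p⟩

theorem carriesCells (h : MapsInto g S T) (h' : MapsInto g⁻¹ T S) {A B : Set (Set Coord)}
    (hA : ∀ K ∈ A, K ⊆ S.realization ∧ act g '' K ∈ B) (hB : ∀ K ∈ B, act g⁻¹ '' K ∈ A) :
    CarriesCells (h.realizationEquiv h') A B := by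
  have key : ∀ K ⊆ S.realization, (fun p : S.realization => (h.realizationEquiv h' p : Coord)) ''
      {p | (p : Coord) ∈ K} = act g '' K := by
    intro K hK
    ext q
    constructor
    · rintro ⟨p, hp, rfl⟩
      exact ⟨p, hp, rfl⟩
    · rintro ⟨p, hp, rfl⟩
      exact ⟨⟨p, hK hp⟩, hp, rfl⟩
  ext K
  constructor
  · rintro ⟨K, hK, rfl⟩
    have := (hA K hK).2
    rwa [← key K (hA K hK).1] at this
  · intro hK
    refine ⟨act g⁻¹ '' K, hB K hK, ?_⟩
    change (fun p : S.realization => (h.realizationEquiv h' p : Coord)) '' _ = K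
    rw [key _ (hA _ (hB K hK)).1, Set.image_image]
    simp [act_act_inv]

theorem isIsometricIso (h : MapsInto g S T) (h' : MapsInto g⁻¹ T S) :
    IsIsometricIso (h.realizationEquiv h') where
  isometry p q := le_antisymm (h.pathDist_le p q _ _ rfl rfl)
    (h'.pathDist_le _ _ p q (act_inv_act g p).symm (act_inv_act g q).symm)
  vertices := by
    have key : ∀ {g : AutF2} {S T : Subcomplex}, MapsInto g S T → ∀ K ∈ S.vertexCells,
        act g '' K ∈ T.vertexCells := by
      rintro g S T h _ ⟨v, hv, rfl⟩
      exact ⟨_, h.verts v hv, by rw [image_act_closedSimplex]; simp [imageVertices]⟩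
    refine carriesCells h h' (fun K hK => ⟨?_, key h K hK⟩) (key h')
    obtain ⟨v, hv, rfl⟩ := hK
    exact Set.subset_biUnion_of_mem (u := closedSimplex) (Or.inl ⟨v, hv, rfl⟩)
  edges := by
    have key : ∀ {g : AutF2} {S T : Subcomplex}, MapsInto g S T → ∀ K ∈ S.edgeCells,
        act g '' K ∈ T.edgeCells := by
      rintro g S T h _ ⟨e, he, rfl⟩
      exact ⟨_, h.edges e he, (image_act_closedSimplex g e).symm⟩
    refine carriesCells h h' (fun K hK => ⟨?_, key h K hK⟩) (key h')
    obtain ⟨e, he, rfl⟩ := hK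
    exact Set.subset_biUnion_of_mem (u := closedSimplex) (Or.inr (Or.inl he))
  triangles := by
    have key : ∀ {g : AutF2} {S T : Subcomplex}, MapsInto g S T → ∀ K ∈ S.triangleCells,
        act g '' K ∈ T.triangleCells := by
      rintro g S T h _ ⟨f, ⟨hf, ht⟩, rfl⟩
      exact ⟨_, ⟨h.faces f hf, ht.imageVertices g⟩, (image_act_closedFace g f).symm⟩
    refine carriesCells h h' (fun K hK => ⟨?_, key h K hK⟩) (key h')
    obtain ⟨f, ⟨hf, -⟩, rfl⟩ := hK
    exact Set.iUnion₂_subset fun s hs =>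
      Set.subset_biUnion_of_mem (u := closedSimplex) (Or.inr (Or.inr ⟨f, hf, hs⟩))
  lozenges := by
    have key : ∀ {g : AutF2} {S T : Subcomplex}, MapsInto g S T → ∀ K ∈ S.lozengeCells,
        act g '' K ∈ T.lozengeCells := by
      rintro g S T h _ ⟨f, ⟨hf, ht⟩, rfl⟩
      exact ⟨_, ⟨h.faces f hf, ht.imageVertices g⟩, (image_act_closedFace g f).symm⟩
    refine carriesCells h h' (fun K hK => ⟨?_, key h K hK⟩) (key h')
    obtain ⟨f, ⟨hf, -⟩, rfl⟩ := hK
    exact Set.iUnion₂_subset fun s hs =>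
      Set.subset_biUnion_of_mem (u := closedSimplex) (Or.inr (Or.inr ⟨f, hf, hs⟩))

end MapsInto

end Subcomplex

/-! ### The action of `Aut(F₂)` on the two Hamiltonian surfaces -/

theorem mapsInto_surface {g : AutF2} {ε ε' : F2 → F2 → Prop}
    (h : ∀ a b, IsBasis a b → ε a b → ε' (g a) (g b)) :
    Subcomplex.MapsInto g (surface ε) (surface ε') where
  verts _ hv := hv.image g
  edges _ he := he.imageVertices g
  faces f hf := by
    rcases hf with ht | ⟨a, b, hab, ha, rfl⟩
    · exact Or.inl (ht.imageVertices g)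
    · exact Or.inr ⟨g a, g b, hab.map g, h a b hab ha, image_lozenge g a b⟩

theorem IsAlternating.comp {ε : F2 → F2 → Prop} (hε : IsAlternating ε) (g : AutF2) :
    IsAlternating fun a b => ε (g a) (g b) where
  swap h := hε.swap (h.map g)
  inv_left h := by simpa using hε.inv_left (h.map g)
  mul_right h := by simpa using hε.mul_right (h.map g)

theorem isPositive_map_iff (g : AutF2) {a b : F2} (h : IsBasis a b) :
    IsPositive (g a) (g b) ↔ (IsPositive a b ↔ IsPositive (g (.of 0)) (g (.of 1))) := by
  have hg := isAlternating_isPositive.comp g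
  by_cases h0 : IsPositive (g (.of 0)) (g (.of 1))
  · rw [iff_true_right h0]
    exact hg.iff_of_iff isAlternating_isPositive (iff_of_true h0 isPositive_of_of) h
  · rw [iff_false_right h0]
    exact hg.iff_of_iff isAlternating_isPositive.not
      (iff_of_false h0 (not_not.2 isPositive_of_of)) h

open Classical in
/-- The signature of the permutation of the three nonzero vectors modulo 2 which is induced by an
automorphism. -/
noncomputable def signature : AutF2 →* ℤˣ where
  toFun g := if IsPositive (g (.of 0)) (g (.of 1)) then 1 else -1
  map_one' := if_pos isPositive_of_of
  map_mul' g h := by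
    have := isPositive_map_iff g (a := h (.of 0)) (b := h (.of 1)) ⟨h, rfl, rfl⟩
    rw [← MulAut.mul_apply, ← MulAut.mul_apply] at this
    simp only [this]
    split_ifs <;> simp_all

theorem isPositive_map_iff_of_mem {g : AutF2} (hg : g ∈ signature.ker) {a b : F2}
    (h : IsBasis a b) : IsPositive (g a) (g b) ↔ IsPositive a b := by
  suffices h0 : IsPositive (g (.of 0)) (g (.of 1)) by rw [isPositive_map_iff g h, iff_true_right h0]
  by_contra h0
  have : signature g = -1 := if_neg h0
  rw [MonoidHom.mem_ker, this] at hg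
  exact absurd hg (by decide)

theorem isPositive_swapAut {a b : F2} (h : IsBasis a b) :
    IsPositive (swapAut a) (swapAut b) ↔ ¬ IsPositive a b := by
  have h0 : ¬ IsPositive (swapAut (.of 0)) (swapAut (.of 1)) := by
    rw [swapAut_zero, swapAut_one, isAlternating_isPositive.swap .of_of, not_not]
    exact isPositive_of_of
  rw [isPositive_map_iff _ h, iff_false_right h0]

theorem stabilizes_surface {ε : F2 → F2 → Prop}
    (h : ∀ g ∈ signature.ker, ∀ a b, IsBasis a b → (ε (g a) (g b) ↔ ε a b)) :
    Subcomplex.Stabilizes signature.ker (surface ε) := fun g hg =>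
  Subcomplex.MapsInto.image_act_realization
    (mapsInto_surface fun a b hab => (h g hg a b hab).2)
    (mapsInto_surface fun a b hab => (h _ (inv_mem hg) a b hab).2)

/-- Two surfaces which are stabilized by the kernel of the signature, and which are exchanged by
`swapAut`, are equivariantly isometric: the isometry is given by `swapAut`, and the isomorphism by
conjugation by `swapAut`. -/
theorem exists_isIsometricIso {S T : Subcomplex}
    (hS : Subcomplex.Stabilizes signature.ker S) (hT : Subcomplex.Stabilizes signature.ker T)
    (h : Subcomplex.MapsInto swapAut S T) (h' : Subcomplex.MapsInto swapAut⁻¹ T S) :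
    ∃ G₁ G₂ : Subgroup Brady.AutF2,
      G₁.FiniteIndex ∧ G₂.FiniteIndex ∧
      ∃ (h₁ : Brady.Subcomplex.Stabilizes G₁ S) (_ : Brady.Subcomplex.Stabilizes G₂ T)
        (φ : G₁ ≃* G₂) (ψ : S.realization ≃ T.realization),
        Brady.Subcomplex.IsIsometricIso ψ ∧
        ∀ (g : G₁) (x : S.realization),
          (ψ ⟨Brady.act (g : Brady.AutF2) x, h₁.act_mem g x⟩ : Brady.Coord) =
            Brady.act (φ g : Brady.AutF2) (ψ x : Brady.Coord) := by
  refine ⟨signature.ker, signature.ker, inferInstance, inferInstance, hS, hT,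
    MulAut.conjNormal swapAut, h.realizationEquiv h', h.isIsometricIso h', fun g x => ?_⟩
  change act swapAut (act g x) = act (MulAut.conjNormal swapAut g : signature.ker) (act swapAut x)
  rw [MulAut.conjNormal_apply, ← act_mul, ← act_mul, inv_mul_cancel_right]

end Brady

theorem theorem1p4 :
    {S : Brady.Subcomplex | S.IsHamiltonianSurface}.ncard = 2 ∧
    ∀ S₁ S₂ : Brady.Subcomplex,
      S₁.IsHamiltonianSurface → S₂.IsHamiltonianSurface → S₁ ≠ S₂ →
      ∃ G₁ G₂ : Subgroup Brady.AutF2,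
        G₁.FiniteIndex ∧ G₂.FiniteIndex ∧
        ∃ (h₁ : Brady.Subcomplex.Stabilizes G₁ S₁) (_ : Brady.Subcomplex.Stabilizes G₂ S₂)
          (φ : G₁ ≃* G₂) (ψ : S₁.realization ≃ S₂.realization),
          Brady.Subcomplex.IsIsometricIso ψ ∧
          ∀ (g : G₁) (x : S₁.realization),
            (ψ ⟨Brady.act (g : Brady.AutF2) x, h₁.act_mem g x⟩ : Brady.Coord) =
              Brady.act (φ g : Brady.AutF2) (ψ x : Brady.Coord) := by
  refine ⟨Brady.ncard_isHamiltonianSurface, fun S₁ S₂ h₁ h₂ hne => ?_⟩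
  have hP := Brady.stabilizes_surface fun g hg a b h => Brady.isPositive_map_iff_of_mem hg h
  have hN := Brady.stabilizes_surface (ε := fun a b => ¬ Brady.IsPositive a b)
    fun g hg a b h => not_congr (Brady.isPositive_map_iff_of_mem hg h)
  have hPN : Brady.Subcomplex.MapsInto Brady.swapAut (Brady.surface Brady.IsPositive)
      (Brady.surface fun a b => ¬ Brady.IsPositive a b) :=
    Brady.mapsInto_surface fun a b h hab => by rwa [Brady.isPositive_swapAut h, not_not]
  have hNP : Brady.Subcomplex.MapsInto Brady.swapAut
      (Brady.surface fun a b => ¬ Brady.IsPositive a b) (Brady.surface Brady.IsPositive) :=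
    Brady.mapsInto_surface fun a b h hab => (Brady.isPositive_swapAut h).2 hab
  -- `swapAut` is an involution, so that `swapAut⁻¹` is `swapAut` by definition
  rcases Brady.isHamiltonianSurface_iff.1 h₁ with rfl | rfl <;>
    rcases Brady.isHamiltonianSurface_iff.1 h₂ with rfl | rfl
  · exact absurd rfl hne
  · exact Brady.exists_isIsometricIso hP hN hPN hNP
  · exact Brady.exists_isIsometricIso hN hP hNP hPN
  · exact absurd rfl hne
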